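/- Let $d\ge 2$, let $\Omega\subset\mathbb R^d$ be a bounded Lipschitz domain, $T>0$, $\nu\ge 0$. Let $C^\infty_{c,\sigma}(\Omega)$ be the smooth divergence-free vector fields with compact support in $\Omega$, and let $L^2_\sigma(\Omega)$, $H^1_{0,\sigma}(\Omega)$ be its closures in $L^2(\Omega)$, $H^1(\Omega)$. Put $\mathbb X=L^\infty(0,T;L^2_\sigma(\Omega))\cap L^2(0,T;H^1_{0,\sigma}(\Omega))$ and $\mathbb Y=\mathbb X\cap L^2(0,T;H^2(\Omega))\cap L^1(0,T;W^{1,\infty}(\Omega))\cap H^1(0,T;L^2_\sigma(\Omega)^*)$ if $\nu>0$, and $\mathbb X=L^\infty(0,T;L^2_\sigma(\Omega))$, $\mathbb Y=\mathbb X\cap L^1(0,T;W^{1,\infty}(\Omega))\cap H^1(0,T;L^2_\sigma(\Omega)^*)$ if $\nu=0$. Let $f\in L^2(0,T;H^{-1}(\Omega))+L^1(0,T;L^2(\Omega))$ if $\nu>0$, $f\in L^1(0,T;L^2(\Omega))$ if $\nu=0$, and $v_0\in L^2_\sigma(\Omega)$. Write $(\cdot,\cdot)$ for $L^2$ inner products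 (Frobenius for matrix fields), $(\nabla w)_{ij}=\partial_j w_i$, $A_{\rm sym}=\frac12(A+A^T)$, $\mathcal R(v|w)=\frac12\|v-w\|_{L^2(\Omega)}^2$ and, for $w\in\mathbb Y$, $$\langle\mathcal A_\nu(w),z\rangle=\langle\partial_t w,z\rangle+((w\cdot\nabla)w,z)+\nu(\nabla w,\nabla z)-\langle f,z\rangle .$$ For $K:L^2_\sigma(\Omega)\to[0,\infty]$ let $\mathcal D(K)=\{w\in\mathbb X: K(w)\in L^1(0,T)\}$ and $$\mathcal W_\nu(v|w)=\nu\|\nabla v-\nabla w\|_{L^2(\Omega)}^2-(((v-w)\cdot\nabla)(v-w),w)+K(w)\mathcal R(v|w)\quad(\nu>0),$$ $$\mathcal W_0(v|w)=\int_\Omega (v-w)^T(\nabla w)_{\rm sym}(v-w)\,dx+K(w)\mathcal R(v|w)\quad(\nu=0).$$ $K$ is called admissible if $K(0)=0$, there is a topology on $\mathcal D(K)$ for which $K:\mathcal D(K)\to L^1(0,T)$ is continuous and $C^1([0,T];C^\infty_{c,\sigma}(\Omega))\subset\mathcal D(K)$ is dense, and $\mathcal W_\nu(v|w)\ge0$ a.e.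 in $(0,T)$ for all $v\in\mathbb X$, $w\in\mathbb Y\cap\mathcal D(K)$. A pair $(v,\xi)\in\mathbb X\times L^\infty(0,T)$ is an energy-variational solution if $\xi\ge0$ on $(0,T)$, the initial value $v(0)=v_0$ is attained in the weak sense (weakly in $L^2_\sigma(\Omega)$ as $t\searrow0$), and for every admissible $K$, every $w\in\mathbb Y\cap\mathcal D(K)$ and a.e. $s<t$ in $(0,T)$ $$\mathcal R(v(t)|w(t))+\xi(t)+\int_s^t\Big(\mathcal W_\nu(v|w)+\langle\mathcal A_\nu(w),v-w\rangle-K(w)\big(\mathcal R(v|w)+\xi\big)\Big)d\tau\le\mathcal R(v(s)|w(s))+\xi(s).$$ **Proposition.** Let $(v,\xi)$ be an energy-variational solution, and let $K$ be an admissible form that is homogeneous of degree one, i.e. $K(\alpha u)=|\alpha|K(u)$ for all $\alpha\in\mathbb R$, $u\in L^2_\sigma(\Omega)$. Then for all $0<s<t<T$ the following holds, all integrands below being integrable. With $E=\frac12\|v\|_{L^2(\Omega)}^2+\xi$, $$E(r)-E(q)+\int_q^r\big(\nu\|\nabla v\|_{L^2(\Omega)}^2-\langle f,v\rangle\big)\,d\tau\le0\qquad\text{for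 a.e. } q<r \text{ in } (s,t),$$ and, for all $\tilde v\in C^1_c((s,t);C^\infty_{c,\sigma}(\Omega))\cap\mathcal D(K)$ (extended by zero to $(0,T)$), $$\Big|\int_s^t\Big(\nu(\nabla v,\nabla\tilde v)-(v\otimes v;\nabla\tilde v)-(v,\partial_t\tilde v)-\langle f,\tilde v\rangle\Big)\,d\tau\Big|\le\int_s^t K(\tilde v)\,\xi\,d\tau .$$ -/

import Mathlib

open MeasureTheory Filter Topology
open scoped ENNReal ContDiff

noncomputable section

namespace EVS

/-- Vectors of `ℝ^d` with the Euclidean norm. -/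
abbrev Vec (d : ℕ) := EuclideanSpace ℝ (Fin d)

/-- `d × d` matrices with the Frobenius norm; the entry `(i, j)` of a gradient is `∂ⱼ uᵢ`. -/
abbrev Mat (d : ℕ) := EuclideanSpace ℝ (Fin d × Fin d)

/-- A bounded Lipschitz domain: bounded, open, connected, and near each boundary point the set
of points above the graph of a Lipschitz function over a hyperplane `nᗮ`, `|n| = 1`. -/
structure IsBoundedLipschitzDomain {d : ℕ} (Ω : Set (Vec d)) : Prop where
  isOpen : IsOpen Ω
  isConnected : IsConnected Ω
  isBounded : Bornology.IsBounded Ω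
  lipschitz_boundary : ∀ p ∈ frontier Ω, ∃ r > (0 : ℝ), ∃ n : Vec d, ‖n‖ = 1 ∧
    ∃ (L : NNReal) (γ : Vec d → ℝ), LipschitzWith L γ ∧
      Ω ∩ Metric.ball p r =
        {x | γ (x - (inner ℝ n x) • n) < inner ℝ n x} ∩ Metric.ball p r

/-! ### Test functions -/

/-- `φ ∈ C_c^∞(U; F)`, extended by zero to the whole space. -/
def IsTest {X F : Type*} [NormedAddCommGroup X] [NormedSpace ℝ X]
    [NormedAddCommGroup F] [NormedSpace ℝ F] (U : Set X) (φ : X → F) : Prop :=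
  ContDiff ℝ ∞ φ ∧ HasCompactSupport φ ∧ tsupport φ ⊆ U

/-- The classical gradient of a vector field. -/
def gradMat {d : ℕ} (φ : Vec d → Vec d) (x : Vec d) : Mat d :=
  WithLp.toLp 2 fun p => fderiv ℝ φ x (EuclideanSpace.single p.2 1) p.1

/-- The classical divergence of a vector field. -/
def divergence {d : ℕ} (φ : Vec d → Vec d) (x : Vec d) : ℝ :=
  ∑ i, fderiv ℝ φ x (EuclideanSpace.single i 1) i

/-- `φ ∈ C_{c,σ}^∞(Ω; ℝ^d)`: smooth solenoidal fields with compact support in `Ω`. -/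
def IsSolTest {d : ℕ} (Ω : Set (Vec d)) (φ : Vec d → Vec d) : Prop :=
  IsTest Ω φ ∧ ∀ x, divergence φ x = 0

/-- `φ ∈ C¹(ℝ; C_{c,σ}^∞(Ω; ℝ^d))`: the supports lie in one compact subset of `Ω`, and `φ` and
`∂ₜφ` have spatial derivatives of every order that are jointly continuous in time and space. -/
structure IsC1Test {d : ℕ} (Ω : Set (Vec d)) (φ : ℝ → Vec d → Vec d) : Prop where
  support : ∃ C : Set (Vec d), IsCompact C ∧ C ⊆ Ω ∧ ∀ t, ∀ x ∉ C, φ t x = 0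
  smooth : ∀ t, ContDiff ℝ ∞ (φ t)
  solenoidal : ∀ t x, divergence (φ t) x = 0
  differentiable : ∀ x, Differentiable ℝ fun t => φ t x
  smooth_deriv : ∀ t, ContDiff ℝ ∞ fun x => deriv (fun τ => φ τ x) t
  continuous : ∀ n : ℕ, Continuous fun p : ℝ × Vec d => iteratedFDeriv ℝ n (φ p.1) p.2
  continuous_deriv : ∀ n : ℕ, Continuous fun p : ℝ × Vec d =>
    iteratedFDeriv ℝ n (fun x => deriv (fun τ => φ τ x) p.1) p.2

/-- `φ ∈ C¹_c((s,t); C_{c,σ}^∞(Ω; ℝ^d))`, extended by zero. -/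
def IsC1cTest {d : ℕ} (Ω : Set (Vec d)) (s t : ℝ) (φ : ℝ → Vec d → Vec d) : Prop :=
  IsC1Test Ω φ ∧ ∃ a b, s < a ∧ a ≤ b ∧ b < t ∧ ∀ τ ∉ Set.Icc a b, ∀ x, φ τ x = 0

/-! ### Function spaces on `Ω` -/

/-- `L^p(Ω; ℝ^ι)`. -/
abbrev LpOn {d : ℕ} (Ω : Set (Vec d)) (ι : Type) [Fintype ι] (p : ℝ≥0∞) :=
  Lp (EuclideanSpace ℝ ι) p (volume.restrict Ω)

/-- `L²(Ω; ℝ^d)`. -/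
abbrev L2 {d : ℕ} (Ω : Set (Vec d)) := LpOn Ω (Fin d) 2

/-- `L²(Ω; ℝ^{d×d})`. -/
abbrev L2Mat {d : ℕ} (Ω : Set (Vec d)) := LpOn Ω (Fin d × Fin d) 2

/-- `L²_σ(Ω)`: the closure of `C_{c,σ}^∞(Ω; ℝ^d)` in `L²(Ω)`. -/
def L2sigma {d : ℕ} (Ω : Set (Vec d)) : Submodule ℝ (L2 Ω) :=
  (Submodule.span ℝ {u : L2 Ω | ∃ φ, IsSolTest Ω φ ∧ u =ᵐ[volume.restrict Ω] φ}).topologicalClosure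

/-- The closure of a set `A` of smooth compactly supported fields with respect to the norm
`(‖u‖² + ‖∇u‖²)^{1/2}` of `H¹(Ω)`; an element is recorded as the pair `(u, ∇u)`. -/
def H1closure {d : ℕ} (Ω : Set (Vec d)) (A : Set (Vec d → Vec d)) :
    Submodule ℝ (WithLp 2 (L2 Ω × L2Mat Ω)) :=
  (Submodule.span ℝ {p : WithLp 2 (L2 Ω × L2Mat Ω) | ∃ φ ∈ A,
    p.fst =ᵐ[volume.restrict Ω] φ ∧ p.snd =ᵐ[volume.restrict Ω] gradMat φ}).topologicalClosure

/-- `H¹_0(Ω; ℝ^d)`, as the space of pairs `(u, ∇u)`. -/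
def H10 {d : ℕ} (Ω : Set (Vec d)) : Submodule ℝ (WithLp 2 (L2 Ω × L2Mat Ω)) :=
  H1closure Ω {φ | IsTest Ω φ}

/-- `H¹_{0,σ}(Ω)`, as the space of pairs `(u, ∇u)`. -/
def H10sigma {d : ℕ} (Ω : Set (Vec d)) : Submodule ℝ (WithLp 2 (L2 Ω × L2Mat Ω)) :=
  H1closure Ω {φ | IsSolTest Ω φ}

/-- `G` is the weak gradient of `u` in `Ω`. -/
def IsWeakGrad {d : ℕ} (Ω : Set (Vec d)) {ι : Type} [Fintype ι]
    (u : Vec d → EuclideanSpace ℝ ι) (G : Vec d → EuclideanSpace ℝ (ι × Fin d)) : Prop :=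
  ∀ η : Vec d → ℝ, IsTest Ω η → ∀ (i : ι) (j : Fin d),
    ∫ x in Ω, u x i * fderiv ℝ η x (EuclideanSpace.single j 1) = -∫ x in Ω, G x (i, j) * η x

open Classical in
/-- The weak gradient of `u ∈ L²(Ω; ℝ^d)` if there is one in `L²` (it is then unique), else `0`. -/
def weakGrad {d : ℕ} {Ω : Set (Vec d)} (u : L2 Ω) : L2Mat Ω :=
  if h : ∃ G : L2Mat Ω, IsWeakGrad Ω u G then h.choose else 0

/-! ### Function spaces in time -/

/-- Lebesgue measure on `(0,T)`. -/
def timeMeasure (T : ℝ) : Measure ℝ := volume.restrict (Set.Ioo 0 T)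

/-- `v ∈ 𝕏`: `v ∈ L^∞(0,T; L²_σ(Ω))` and, if `ν > 0`, also `v ∈ L²(0,T; H¹_{0,σ}(Ω))`. -/
def MemX {d : ℕ} {Ω : Set (Vec d)} (ν T : ℝ) (v : ℝ → L2sigma Ω) : Prop :=
  MemLp v ⊤ (timeMeasure T) ∧
  (0 < ν → ∃ G : ℝ → L2Mat Ω, MemLp G 2 (timeMeasure T) ∧
    ∀ᵐ t ∂timeMeasure T, WithLp.toLp 2 ((v t : L2 Ω), G t) ∈ H10sigma Ω)

/-- `w ∈ L¹(0,T; W^{1,∞}(Ω))`. -/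
def MemL1W1inf {d : ℕ} {Ω : Set (Vec d)} (T : ℝ) (w : ℝ → L2sigma Ω) : Prop :=
  ∃ (U : ℝ → LpOn Ω (Fin d) ⊤) (G : ℝ → LpOn Ω (Fin d × Fin d) ⊤),
    MemLp U 1 (timeMeasure T) ∧ MemLp G 1 (timeMeasure T) ∧
    ∀ᵐ t ∂timeMeasure T,
      ((w t : L2 Ω) : Vec d → Vec d) =ᵐ[volume.restrict Ω] U t ∧ IsWeakGrad Ω (U t) (G t)

/-- `w ∈ L²(0,T; H²(Ω))`. -/
def MemL2H2 {d : ℕ} {Ω : Set (Vec d)} (T : ℝ) (w : ℝ → L2sigma Ω) : Prop :=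
  MemLp w 2 (timeMeasure T) ∧
  ∃ (G : ℝ → L2Mat Ω) (H : ℝ → LpOn Ω ((Fin d × Fin d) × Fin d) 2),
    MemLp G 2 (timeMeasure T) ∧ MemLp H 2 (timeMeasure T) ∧
    ∀ᵐ t ∂timeMeasure T, IsWeakGrad Ω (w t : L2 Ω) (G t) ∧ IsWeakGrad Ω (G t) (H t)

/-- `w ∈ H¹(0,T; L²_σ(Ω)^*)` with weak time derivative `w'`, where `L²_σ(Ω)^*` is identified with
`L²_σ(Ω)` by the Riesz isomorphism. -/
def HasL2TimeDeriv {d : ℕ} {Ω : Set (Vec d)} (T : ℝ) (w w' : ℝ → L2sigma Ω) : Prop :=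
  MemLp w 2 (timeMeasure T) ∧ MemLp w' 2 (timeMeasure T) ∧
  ∀ η : ℝ → ℝ, IsTest (Set.Ioo 0 T) η →
    ∫ t, deriv η t • w t ∂timeMeasure T = -∫ t, η t • w' t ∂timeMeasure T

/-- `w ∈ 𝕐` with time derivative `w'`: `w ∈ 𝕏 ∩ L¹(0,T; W^{1,∞}(Ω)) ∩ H¹(0,T; L²_σ(Ω)^*)` and,
if `ν > 0`, also `w ∈ L²(0,T; H²(Ω))`. -/
def MemY {d : ℕ} {Ω : Set (Vec d)} (ν T : ℝ) (w w' : ℝ → L2sigma Ω) : Prop :=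
  MemX ν T w ∧ MemL1W1inf T w ∧ HasL2TimeDeriv T w w' ∧ (0 < ν → MemL2H2 T w)

/-- A force `f = f₁ + f₂` with `f₁(t) ∈ H^{-1}(Ω) = H¹_0(Ω)^*` and `f₂(t) ∈ L²(Ω)`. -/
structure Force {d : ℕ} (Ω : Set (Vec d)) where
  /-- the part with values in `H^{-1}(Ω)` -/
  f₁ : ℝ → StrongDual ℝ (H10 Ω)
  /-- the part with values in `L²(Ω)` -/
  f₂ : ℝ → L2 Ω

/-- `f ∈ ℤ`: `f ∈ L²(0,T; H^{-1}(Ω)) + L¹(0,T; L²(Ω))` if `ν > 0`, and `f ∈ L¹(0,T; L²(Ω))`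
otherwise. -/
def MemZ {d : ℕ} {Ω : Set (Vec d)} (ν T : ℝ) (f : Force Ω) : Prop :=
  MemLp f.f₂ 1 (timeMeasure T) ∧ (0 < ν → MemLp f.f₁ 2 (timeMeasure T)) ∧
  (¬ 0 < ν → ∀ᵐ t ∂timeMeasure T, f.f₁ t = 0)

open Classical in
/-- The pairing `⟨f(t), u⟩ = ⟨f₁(t), u⟩ + (f₂(t), u)`; the first summand is read as `0` if
`u ∉ H¹_0(Ω)`, which matters only where `f₁ = 0`. -/
def Force.pairing {d : ℕ} {Ω : Set (Vec d)} (f : Force Ω) (t : ℝ) (u : L2 Ω) : ℝ :=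
  (if h : WithLp.toLp 2 (u, weakGrad u) ∈ H10 Ω then f.f₁ t ⟨_, h⟩ else 0) + inner ℝ (f.f₂ t) u

/-! ### The forms of the equation -/

/-- The relative energy `ℛ(u|w) = ½ ‖u - w‖²`. -/
def relEnergy {d : ℕ} {Ω : Set (Vec d)} (u w : L2sigma Ω) : ℝ := 1 / 2 * ‖u - w‖ ^ 2

/-- `((a · ∇) b, c)`. -/
def convForm {d : ℕ} {Ω : Set (Vec d)} (a b c : L2sigma Ω) : ℝ :=
  ∫ x in Ω, ∑ i, ∑ j, (a : L2 Ω) x j * weakGrad (b : L2 Ω) x (i, j) * (c : L2 Ω) x i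

/-- `(u ⊗ u ; ∇w)`. -/
def tensorForm {d : ℕ} {Ω : Set (Vec d)} (u w : L2sigma Ω) : ℝ :=
  ∫ x in Ω, ∑ i, ∑ j, (u : L2 Ω) x i * (u : L2 Ω) x j * weakGrad (w : L2 Ω) x (i, j)

/-- `∫_Ω uᵀ (∇w)_sym u`. -/
def symForm {d : ℕ} {Ω : Set (Vec d)} (u w : L2sigma Ω) : ℝ :=
  ∫ x in Ω, ∑ i, ∑ j, (u : L2 Ω) x i *
    (1 / 2 * (weakGrad (w : L2 Ω) x (i, j) + weakGrad (w : L2 Ω) x (j, i))) * (u : L2 Ω) x j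

/-- The relative form `𝒲_ν(u|w)` for the regularity measure `K`. -/
def relForm {d : ℕ} {Ω : Set (Vec d)} (ν : ℝ) (K : L2sigma Ω → ℝ≥0∞) (u w : L2sigma Ω) : ℝ :=
  if 0 < ν then
    ν * ‖weakGrad (u : L2 Ω) - weakGrad (w : L2 Ω)‖ ^ 2 - convForm (u - w) (u - w) w
      + (K w).toReal * relEnergy u w
  else
    symForm (u - w) w + (K w).toReal * relEnergy u w

/-- `⟨𝒜_ν(w), z⟩ = ⟨∂ₜw + (w·∇)w - νΔw - f, z⟩` at time `t`, in the weak sense in space;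
the argument after `w` stands for `∂ₜw`. -/
def sysOp {d : ℕ} {Ω : Set (Vec d)} (ν : ℝ) (f : Force Ω) (t : ℝ) (w w' z : L2sigma Ω) : ℝ :=
  inner ℝ w' z + convForm w w z + ν * inner ℝ (weakGrad (w : L2 Ω)) (weakGrad (z : L2 Ω))
    - f.pairing t z

/-! ### Regularity measures and solutions -/

/-- `𝒟(K) = {w ∈ 𝕏 | K(w) ∈ L¹(0,T)}`. -/
def domK {d : ℕ} {Ω : Set (Vec d)} (ν T : ℝ) (K : L2sigma Ω → ℝ≥0∞) : Set (ℝ → L2sigma Ω) :=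
  {w | MemX ν T w ∧ AEMeasurable (fun t => K (w t)) (timeMeasure T) ∧
    ∫⁻ t, K (w t) ∂timeMeasure T ≠ ⊤}

/-- `K` as a map from `𝒟(K)` to `L¹(0,T)`. -/
def mapK {d : ℕ} {Ω : Set (Vec d)} (ν T : ℝ) (K : L2sigma Ω → ℝ≥0∞) (w : domK ν T K) :
    Lp ℝ 1 (timeMeasure T) :=
  Integrable.toL1 (fun t => (K (w.1 t)).toReal)
    (integrable_toReal_of_lintegral_ne_top w.2.2.1 w.2.2.2)

/-- `w ∈ C¹([0,T]; C_{c,σ}^∞(Ω; ℝ^d))`. -/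
def IsC1Field {d : ℕ} {Ω : Set (Vec d)} (T : ℝ) (w : ℝ → L2sigma Ω) : Prop :=
  ∃ φ, IsC1Test Ω φ ∧ ∀ t ∈ Set.Icc 0 T, (w t : L2 Ω) =ᵐ[volume.restrict Ω] φ t

/-- Admissible regularity measures. -/
structure IsAdmissible {d : ℕ} {Ω : Set (Vec d)} (ν T : ℝ) (K : L2sigma Ω → ℝ≥0∞) : Prop where
  map_zero : K 0 = 0
  c1_mem : ∀ w : ℝ → L2sigma Ω, IsC1Field T w → w ∈ domK ν T K
  exists_topology : ∃ _ : TopologicalSpace (domK ν T K),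
    Continuous (mapK ν T K) ∧ Dense {w : domK ν T K | IsC1Field T w.1}
  relForm_nonneg : ∀ v w w' : ℝ → L2sigma Ω, MemX ν T v → MemY ν T w w' → w ∈ domK ν T K →
    ∀ᵐ t ∂timeMeasure T, 0 ≤ relForm ν K (v t) (w t)

/-- Energy-variational solutions `(v, ξ)` to the initial value `v₀` and the force `f`. The relative
energy inequality is required for almost all `s < t`. The version for all `s, t` with one-sided
limits `v(t+), ξ(t+), v(s-), ξ(s-)` contains this one, because functions with one-sided limits
are continuous up to a countable set. -/
structure IsEnergyVariationalSolution {d : ℕ} {Ω : Set (Vec d)} (ν T : ℝ) (f : Force Ω)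
    (v₀ : L2sigma Ω) (v : ℝ → L2sigma Ω) (ξ : ℝ → ℝ) : Prop where
  memX : MemX ν T v
  memLp_xi : MemLp ξ ⊤ (timeMeasure T)
  xi_nonneg : ∀ t ∈ Set.Ioo 0 T, 0 ≤ ξ t
  relative_energy : ∀ K : L2sigma Ω → ℝ≥0∞, IsAdmissible ν T K →
    ∀ w w' : ℝ → L2sigma Ω, MemY ν T w w' → w ∈ domK ν T K →
    ∀ᵐ s ∂timeMeasure T, ∀ᵐ t ∂timeMeasure T, s < t →
      relEnergy (v t) (w t) + ξ t
        + ∫ τ in s..t, (relForm ν K (v τ) (w τ) + sysOp ν f τ (w τ) (w' τ) (v τ - w τ)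
            - (K (w τ)).toReal * (relEnergy (v τ) (w τ) + ξ τ))
      ≤ relEnergy (v s) (w s) + ξ s
  /-- the initial value is attained weakly in `L²`, as an essential limit -/
  initial : ∀ z : L2sigma Ω,
    Tendsto (fun t => inner ℝ (v t) z) (𝓝[>] 0 ⊓ ae volume) (𝓝 (inner ℝ v₀ z))

/-- The total energy `½ ‖v(t)‖² + ξ(t)`. -/
def totalEnergy {d : ℕ} {Ω : Set (Vec d)} (v : ℝ → L2sigma Ω) (ξ : ℝ → ℝ) (t : ℝ) : ℝ :=
  1 / 2 * ‖v t‖ ^ 2 + ξ t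

/-- The integrand `ν ‖∇v‖² - ⟨f, v⟩` of the energy inequality. -/
def dissipation {d : ℕ} {Ω : Set (Vec d)} (ν : ℝ) (f : Force Ω) (v : ℝ → L2sigma Ω) (t : ℝ) : ℝ :=
  ν * ‖weakGrad (v t : L2 Ω)‖ ^ 2 - f.pairing t (v t)

/-- The integrand `ν (∇v, ∇w) - (v ⊗ v; ∇w) - (v, ∂ₜw) - ⟨f, w⟩` of the weak formulation, for the
test function `w` that is represented by the smooth field `φ`. -/
def residual {d : ℕ} {Ω : Set (Vec d)} (ν : ℝ) (f : Force Ω) (v : ℝ → L2sigma Ω)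
    (φ : ℝ → Vec d → Vec d) (w : ℝ → L2sigma Ω) (t : ℝ) : ℝ :=
  ν * inner ℝ (weakGrad (v t : L2 Ω)) (weakGrad (w t : L2 Ω)) - tensorForm (v t) (w t)
    - (∫ x in Ω, inner ℝ ((v t : L2 Ω) x) (deriv (fun τ => φ τ x) t)) - f.pairing t (w t)

end EVS

end

/-! Tested with a smooth solenoidal field `w`, the integrand of the relative energy inequality
collapses. Integration by parts turns the convective part of `relForm` into ((v − w)·∇w, v − w) also
for ν > 0. Since (u·∇w, w) = 0 for solenoidal u, adding (w·∇w, v − w) leaves (v ⊗ v; ∇w). The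
viscous terms combine to ν‖∇v‖² − ν(∇v, ∇w), and K(w)ℛ(v|w) cancels. What is left is dissipation −
residual − (∂ₜw, w) − K(w)ξ; this is `IsTestClass.relForm_add_sysOp`.

Here (∂ₜw, w) is the derivative of ½‖w‖², so it integrates to zero between times q < r at which w
vanishes. Hence E(r) − E(q) + ∫ dissipation − ∫ residual − ∫ K(w)ξ ≤ 0
(`IsEnergyVariationalSolution.inequality_of_isTestCurve`). The choice w = 0 is the energy
inequality. Replacing w by nw multiplies the last two integrals by n and |n|, while the rest does
not depend on n; dividing by |n| and letting n → ±∞ gives the bound on the residual. Integers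
suffice and, being countable, share one null set of exceptional times.

The supporting work is of two kinds. `weakGrad` and `Force.pairing` are defined by choice and case
distinction, so uniqueness of weak gradients and density of test fields are needed to compute with
them. Smooth fields must also be admitted as comparison functions: joint continuity with a common
compact support gives continuous and differentiable curves in the sup norm, hence in every L^p. -/

noncomputable section

namespace EVS

/-! ### Gradients of smooth fields -/

/-- The classical gradient of a map with values in `ℝ^ι`. -/
def gradField {d : ℕ} {ι : Type} [Fintype ι] (φ : Vec d → EuclideanSpace ℝ ι) (x : Vec d) :
    EuclideanSpace ℝ (ι × Fin d) :=
  WithLp.toLp 2 fun p => fderiv ℝ φ x (EuclideanSpace.single p.2 1) p.1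

section Space

variable {d : ℕ} {Ω : Set (Vec d)} {ι : Type} [Fintype ι]

lemma gradMat_eq_gradField (φ : Vec d → Vec d) : gradMat φ = gradField φ := rfl

lemma fderiv_coord {φ : Vec d → EuclideanSpace ℝ ι} {x : Vec d} (h : DifferentiableAt ℝ φ x)
    (i : ι) (e : Vec d) : fderiv ℝ (fun y => φ y i) x e = fderiv ℝ φ x e i := by
  have := ((EuclideanSpace.proj (𝕜 := ℝ) i).hasFDerivAt.comp x h.hasFDerivAt).fderiv
  have h2 : (fun y => φ y i) = (EuclideanSpace.proj (𝕜 := ℝ) i) ∘ φ := rfl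
  rw [h2, this]
  rfl

lemma gradField_eq_zero {φ : Vec d → EuclideanSpace ℝ ι} {x : Vec d} (hx : x ∉ tsupport φ) :
    gradField φ x = 0 := by
  have : fderiv ℝ φ x = 0 := by
    by_contra h
    exact hx (support_fderiv_subset ℝ h)
  ext p
  simp [gradField, this]

/-- Integration by parts on `Ω` when the first factor has compact support in `Ω`. -/
lemma setIntegral_mul_fderiv {f g : Vec d → ℝ} (hf : ContDiff ℝ 1 f) (hg : ContDiff ℝ 1 g)
    (hc : HasCompactSupport f) (hs : tsupport f ⊆ Ω) (e : Vec d) :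
    ∫ x in Ω, f x * fderiv ℝ g x e = -∫ x in Ω, fderiv ℝ f x e * g x := by
  have h0 : ∀ x ∉ tsupport f, fderiv ℝ f x = 0 := fun x hx => by
    by_contra h
    exact hx (support_fderiv_subset ℝ h)
  have cf : Continuous fun x => fderiv ℝ f x e :=
    (hf.continuous_fderiv one_ne_zero).clm_apply continuous_const
  have cg : Continuous fun x => fderiv ℝ g x e :=
    (hg.continuous_fderiv one_ne_zero).clm_apply continuous_const
  have i1 : Integrable fun x => fderiv ℝ f x e * g x :=
    (cf.mul hg.continuous).integrable_of_hasCompactSupport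
      (HasCompactSupport.intro hc fun x hx => by simp [h0 x hx])
  have i2 : Integrable fun x => f x * fderiv ℝ g x e :=
    (hf.continuous.mul cg).integrable_of_hasCompactSupport hc.mul_right
  have i3 : Integrable fun x => f x * g x :=
    (hf.continuous.mul hg.continuous).integrable_of_hasCompactSupport hc.mul_right
  rw [setIntegral_eq_integral_of_forall_compl_eq_zero,
    setIntegral_eq_integral_of_forall_compl_eq_zero]
  · exact integral_mul_fderiv_eq_neg_fderiv_mul_of_integrable i1 i2 i3
      (fun x _ => (hf.differentiable one_ne_zero) x)
      (fun x _ => (hg.differentiable one_ne_zero) x)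
  · intro x hx
    simp [h0 x fun h => hx (hs h)]
  · intro x hx
    simp [image_eq_zero_of_notMem_tsupport fun h => hx (hs h)]

/-- The test function carries the compact support, so none is asked of φ. -/
lemma isWeakGrad_gradField {φ : Vec d → EuclideanSpace ℝ ι} (h : ContDiff ℝ 1 φ) :
    IsWeakGrad Ω φ (gradField φ) := by
  intro η hη i j
  have hi : ContDiff ℝ 1 fun x => φ x i := (EuclideanSpace.proj (𝕜 := ℝ) i).contDiff.comp h
  have := setIntegral_mul_fderiv (Ω := Ω) (hη.1.of_le (by exact_mod_cast le_top)) hi hη.2.1 hη.2.2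
    (EuclideanSpace.single j 1)
  simp only [fderiv_coord ((h.differentiable one_ne_zero) _)] at this
  rw [eq_neg_iff_add_eq_zero, add_comm, ← eq_neg_iff_add_eq_zero]
  calc _ = ∫ x in Ω, η x * fderiv ℝ φ x (EuclideanSpace.single j 1) i := by
        simp only [gradField, mul_comm]
    _ = _ := by rw [this]; simp only [mul_comm]

lemma IsWeakGrad.congr {u u' : Vec d → EuclideanSpace ℝ ι}
    {G G' : Vec d → EuclideanSpace ℝ (ι × Fin d)} (h : IsWeakGrad Ω u G)
    (hu : u =ᵐ[volume.restrict Ω] u') (hG : G =ᵐ[volume.restrict Ω] G') : IsWeakGrad Ω u' G' := by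
  intro η hη i j
  have e1 : ∫ x in Ω, u x i * fderiv ℝ η x (EuclideanSpace.single j 1) =
      ∫ x in Ω, u' x i * fderiv ℝ η x (EuclideanSpace.single j 1) :=
    integral_congr_ae (by filter_upwards [hu] with x hx; rw [hx])
  have e2 : ∫ x in Ω, G x (i, j) * η x = ∫ x in Ω, G' x (i, j) * η x :=
    integral_congr_ae (by filter_upwards [hG] with x hx; rw [hx])
  rw [← e1, ← e2]
  exact h η hη i j

lemma memLp_coord {u : Vec d → EuclideanSpace ℝ ι} {p : ℝ≥0∞}
    (hu : MemLp u p (volume.restrict Ω)) (i : ι) :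
    MemLp (fun x => u x i) p (volume.restrict Ω) :=
  (EuclideanSpace.proj (𝕜 := ℝ) i).comp_memLp' hu

lemma memLp_of_hasCompactSupport {F : Type*} [NormedAddCommGroup F] {φ : Vec d → F}
    (h : Continuous φ) (hc : HasCompactSupport φ) (p : ℝ≥0∞) : MemLp φ p (volume.restrict Ω) :=
  h.memLp_of_hasCompactSupport hc

/-- Fundamental lemma of the calculus of variations, entry by entry. It frees `weakGrad` from the
choice in its definition. -/
lemma IsWeakGrad.unique (hΩ : IsOpen Ω) [IsFiniteMeasure (volume.restrict Ω)]
    {u : Vec d → EuclideanSpace ℝ ι} {G H : LpOn Ω (ι × Fin d) 2}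
    (hG : IsWeakGrad Ω u G) (hH : IsWeakGrad Ω u H) : G = H := by
  refine Lp.ext ?_
  have key : ∀ p : ι × Fin d, ∀ᵐ x ∂volume.restrict Ω, G x p = H x p := by
    rintro ⟨i, j⟩
    have mG := memLp_coord (Lp.memLp G) (i, j)
    have mH := memLp_coord (Lp.memLp H) (i, j)
    have hint : Integrable (fun x => G x (i, j) - H x (i, j)) (volume.restrict Ω) :=
      (mG.sub mH).integrable (by norm_num)
    have := hΩ.ae_eq_zero_of_integral_contDiff_smul_eq_zero (μ := volume.restrict Ω)
      (hint.locallyIntegrable.locallyIntegrableOn Ω) (fun η h1 h2 h3 => by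
        have mη : MemLp η 2 (volume.restrict Ω) := memLp_of_hasCompactSupport h1.continuous h2 2
        have e := (hG η ⟨h1, h2, h3⟩ i j).symm.trans (hH η ⟨h1, h2, h3⟩ i j)
        simp only [smul_eq_mul, mul_sub]
        have i1 : Integrable (fun x => η x * G x (i, j)) (volume.restrict Ω) :=
          mη.integrable_mul mG
        have i2 : Integrable (fun x => η x * H x (i, j)) (volume.restrict Ω) :=
          mη.integrable_mul mH
        rw [integral_sub i1 i2]
        simp only [mul_comm (η _)]
        linarith)
    filter_upwards [this, ae_restrict_mem hΩ.measurableSet] with x hx hxΩ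
    exact sub_eq_zero.1 (hx hxΩ)
  filter_upwards [ae_all_iff.2 key] with x hx
  ext p
  exact hx p

lemma weakGrad_eq (hΩ : IsOpen Ω) [IsFiniteMeasure (volume.restrict Ω)] {u : L2 Ω} {G : L2Mat Ω}
    (h : IsWeakGrad Ω u G) : weakGrad u = G := by
  have hex : ∃ G : L2Mat Ω, IsWeakGrad Ω u G := ⟨G, h⟩
  rw [weakGrad, dif_pos hex]
  exact hex.choose_spec.unique hΩ h

/-! ### Density arguments -/

/-- The orthogonal complement of z is a closed subspace, so containing the generators it contains
the closure of their span. -/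
lemma inner_eq_zero_of_mem_L2sigma {z : L2 Ω}
    (h : ∀ (φ : Vec d → Vec d) (u : L2 Ω), IsSolTest Ω φ → u =ᵐ[volume.restrict Ω] φ →
      inner ℝ z u = 0) (u : L2sigma Ω) : inner ℝ z (u : L2 Ω) = 0 := by
  have : L2sigma Ω ≤ (Submodule.span ℝ {z})ᗮ := by
    refine Submodule.topologicalClosure_minimal _ (Submodule.span_le.2 ?_)
      (Submodule.isClosed_orthogonal _)
    rintro w ⟨φ, hφ, hw⟩
    exact Submodule.mem_orthogonal_singleton_iff_inner_right.2 (h φ w hφ hw)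
  exact Submodule.mem_orthogonal_singleton_iff_inner_right.1 (this u.2)

lemma inner_eq_zero_of_mem_H1closure {A : Set (Vec d → Vec d)} {a : L2 Ω} {b : L2Mat Ω}
    (h : ∀ φ ∈ A, ∀ (u : L2 Ω) (G : L2Mat Ω), u =ᵐ[volume.restrict Ω] φ →
      G =ᵐ[volume.restrict Ω] gradMat φ → inner ℝ a u + inner ℝ b G = 0)
    {u : L2 Ω} {G : L2Mat Ω} (hp : WithLp.toLp 2 (u, G) ∈ H1closure Ω A) :
    inner ℝ a u + inner ℝ b G = 0 := by
  have : H1closure Ω A ≤ (Submodule.span ℝ {WithLp.toLp 2 (a, b)})ᗮ := by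
    refine Submodule.topologicalClosure_minimal _ (Submodule.span_le.2 ?_)
      (Submodule.isClosed_orthogonal _)
    rintro w ⟨φ, hφ, hw, hw'⟩
    refine Submodule.mem_orthogonal_singleton_iff_inner_right.2 ?_
    rw [WithLp.prod_inner_apply]
    exact h φ hφ _ _ hw hw'
  have := Submodule.mem_orthogonal_singleton_iff_inner_right.1 (this hp)
  rwa [WithLp.prod_inner_apply] at this

lemma H10sigma_le_H10 : H10sigma Ω ≤ H10 Ω := by
  refine Submodule.topologicalClosure_mono (Submodule.span_mono ?_)
  rintro p ⟨φ, hφ, h⟩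
  exact ⟨φ, hφ.1, h⟩

lemma inner_eq_integral_sum {a b : LpOn Ω ι 2} {f g : Vec d → EuclideanSpace ℝ ι}
    (hf : a =ᵐ[volume.restrict Ω] f) (hg : b =ᵐ[volume.restrict Ω] g) :
    inner ℝ a b = ∫ x in Ω, ∑ i, f x i * g x i := by
  rw [L2.inner_def]
  refine integral_congr_ae ?_
  filter_upwards [hf, hg] with x h1 h2
  rw [h1, h2, PiLp.inner_apply]
  exact Finset.sum_congr rfl fun i _ => by simp [mul_comm]

/-- For fixed η, i, j the defining identity says that (u, G) is orthogonal to the pair (∂ⱼη eᵢ, η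
eᵢⱼ). Orthogonality passes from test fields to their H¹ closure. -/
lemma isWeakGrad_of_mem_H10 [IsFiniteMeasure (volume.restrict Ω)] {u : L2 Ω} {G : L2Mat Ω}
    (hp : WithLp.toLp 2 (u, G) ∈ H10 Ω) : IsWeakGrad Ω u G := by
  classical
  intro η hη i j
  have h1 : ContDiff ℝ 1 η := hη.1.of_le (by exact_mod_cast le_top)
  have m1 : MemLp (fun x => fderiv ℝ η x (EuclideanSpace.single j 1) •
      (EuclideanSpace.single i 1 : Vec d)) 2 (volume.restrict Ω) := by
    refine memLp_of_hasCompactSupport ?_ ?_ 2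
    · exact ((h1.continuous_fderiv one_ne_zero).clm_apply continuous_const).smul continuous_const
    · refine HasCompactSupport.intro hη.2.1 fun x hx => ?_
      have : fderiv ℝ η x = 0 := by
        by_contra h
        exact hx (support_fderiv_subset ℝ h)
      simp [this]
  have m2 : MemLp (fun x => η x • (EuclideanSpace.single (i, j) 1 : Mat d)) 2
      (volume.restrict Ω) := by
    refine memLp_of_hasCompactSupport (h1.continuous.smul continuous_const) hη.2.1.smul_right 2
  have e1 : ∀ (w : L2 Ω) (f : Vec d → Vec d), w =ᵐ[volume.restrict Ω] f →
      inner ℝ (m1.toLp _) w = ∫ x in Ω, f x i * fderiv ℝ η x (EuclideanSpace.single j 1) := by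
    intro w f hw
    rw [inner_eq_integral_sum m1.coeFn_toLp hw]
    refine integral_congr_ae (.of_forall fun x => ?_)
    simp [mul_comm]
  have e2 : ∀ (w : L2Mat Ω) (f : Vec d → Mat d), w =ᵐ[volume.restrict Ω] f →
      inner ℝ (m2.toLp _) w = ∫ x in Ω, f x (i, j) * η x := by
    intro w f hw
    rw [inner_eq_integral_sum m2.coeFn_toLp hw]
    refine integral_congr_ae (.of_forall fun x => ?_)
    simp [mul_comm]
  have := inner_eq_zero_of_mem_H1closure (a := m1.toLp _) (b := m2.toLp _)
    (fun φ hφ u G hu hG => by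
      rw [e1 u φ hu, e2 G _ hG, gradMat_eq_gradField,
        isWeakGrad_gradField (Ω := Ω) (hφ.1.of_le (by exact_mod_cast le_top)) η hη i j]
      ring) hp
  rw [e1 u _ (ae_eq_refl _), e2 G _ (ae_eq_refl _)] at this
  linarith

/-- The gradient of a scalar function. -/
def gradScalar (η : Vec d → ℝ) (x : Vec d) : Vec d :=
  WithLp.toLp 2 fun j => fderiv ℝ η x (EuclideanSpace.single j 1)

lemma memLp_gradScalar {η : Vec d → ℝ} (hη : ContDiff ℝ 1 η) (hc : HasCompactSupport η)
    (p : ℝ≥0∞) : MemLp (gradScalar η) p (volume.restrict Ω) := by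
  refine memLp_of_hasCompactSupport ?_ (HasCompactSupport.intro hc fun x hx => ?_) p
  · refine (PiLp.continuous_toLp 2 _).comp (continuous_pi fun j => ?_)
    exact (hη.continuous_fderiv one_ne_zero).clm_apply continuous_const
  · have : fderiv ℝ η x = 0 := by
      by_contra h
      exact hx (support_fderiv_subset ℝ h)
    ext j
    simp [gradScalar, this]

/-- Solenoidal fields are orthogonal to gradients. -/
lemma inner_gradient_eq_zero {η : Vec d → ℝ} (hη : ContDiff ℝ 1 η) {z : L2 Ω}
    (hz : z =ᵐ[volume.restrict Ω]
      gradScalar η)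
    (u : L2sigma Ω) : inner ℝ z (u : L2 Ω) = 0 := by
  refine inner_eq_zero_of_mem_L2sigma (fun φ w hφ hw => ?_) u
  have hφ1 : ContDiff ℝ 1 φ := hφ.1.1.of_le (by exact_mod_cast le_top)
  have hc : ∀ j, ContDiff ℝ 1 fun x => φ x j := fun j =>
    (EuclideanSpace.proj (𝕜 := ℝ) j).contDiff.comp hφ1
  have hsub : ∀ j, tsupport (fun x => φ x j) ⊆ tsupport φ := fun j =>
    closure_mono fun x hx => by
      intro h
      exact hx (by simp [h])
  have hcs : ∀ j, HasCompactSupport fun x => φ x j := fun j =>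
    hφ.1.2.1.mono fun x hx h => hx (by simp [h])
  rw [inner_eq_integral_sum hz hw]
  simp only [gradScalar]
  rw [integral_finsetSum]
  · have : ∀ j, ∫ x in Ω, fderiv ℝ η x (EuclideanSpace.single j 1) * φ x j =
        -∫ x in Ω, fderiv ℝ φ x (EuclideanSpace.single j 1) j * η x := by
      intro j
      have := setIntegral_mul_fderiv (hc j) hη (hcs j) ((hsub j).trans hφ.1.2.2)
        (EuclideanSpace.single j 1)
      simp only [fderiv_coord ((hφ1.differentiable one_ne_zero) _)] at this
      rw [← this]
      simp only [mul_comm]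
    simp only [this]
    -- After integration by parts the derivatives of φ add up to its divergence.
    rw [Finset.sum_neg_distrib, ← integral_finsetSum]
    · simp only [← Finset.sum_mul]
      have h0 : ∀ x, ∑ i, fderiv ℝ φ x (EuclideanSpace.single i 1) i = 0 := hφ.2
      simp [h0]
    · intro j _
      have c1 : Continuous fun x => fderiv ℝ φ x (EuclideanSpace.single j 1) j :=
        (EuclideanSpace.proj (𝕜 := ℝ) j).continuous.comp
          ((hφ1.continuous_fderiv one_ne_zero).clm_apply continuous_const)
      refine ((c1.mul hη.continuous).integrable_of_hasCompactSupport ?_).integrableOn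
      refine HasCompactSupport.intro hφ.1.2.1 fun x hx => ?_
      have : fderiv ℝ φ x = 0 := by
        by_contra h
        exact hx (support_fderiv_subset ℝ h)
      simp [this]
  · intro j _
    refine Integrable.integrableOn (Continuous.integrable_of_hasCompactSupport ?_ ?_)
    · exact ((hη.continuous_fderiv one_ne_zero).clm_apply continuous_const).mul (hc j).continuous
    · exact (hcs j).mul_left

/-! ### The convective form with a smooth argument -/

/-- The product of a matrix and a vector. -/
def matVec (d : ℕ) : Mat d →L[ℝ] Vec d →L[ℝ] Vec d :=
  LinearMap.toContinuousLinearMap (LinearMap.toContinuousLinearMap.toLinearMap ∘ₗ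
    LinearMap.mk₂ ℝ (fun (A : Mat d) (x : Vec d) => (WithLp.toLp 2 fun i => ∑ j, A (i, j) * x j :
      Vec d))
      (fun A B x => by ext i; simp [add_mul, Finset.sum_add_distrib])
      (fun c A x => by ext i; simp [Finset.mul_sum, mul_assoc])
      (fun A x y => by ext i; simp [mul_add, Finset.sum_add_distrib])
      (fun c A x => by ext i; simp [Finset.mul_sum, mul_left_comm]))

/-- The outer product of two vectors. -/
def outer (d : ℕ) : Vec d →L[ℝ] Vec d →L[ℝ] Mat d :=
  LinearMap.toContinuousLinearMap (LinearMap.toContinuousLinearMap.toLinearMap ∘ₗ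
    LinearMap.mk₂ ℝ (fun (x y : Vec d) => (WithLp.toLp 2 fun p => x p.1 * y p.2 : Mat d))
      (fun x x' y => by ext i; simp [add_mul])
      (fun c x y => by ext i; simp [mul_assoc])
      (fun x y y' => by ext i; simp [mul_add])
      (fun c x y => by ext i; simp [mul_left_comm]))

lemma matVec_apply (A : Mat d) (x : Vec d) (i : Fin d) :
    matVec d A x i = ∑ j, A (i, j) * x j := rfl

lemma outer_apply (x y : Vec d) (p : Fin d × Fin d) : outer d x y p = x p.1 * y p.2 := rfl

/-- Multiplication of an `L²` vector field by a bounded matrix field. -/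
def mulField : LpOn Ω (Fin d × Fin d) ⊤ →L[ℝ] L2 Ω →L[ℝ] L2 Ω :=
  (matVec d).holderL (volume.restrict Ω) ⊤ 2 2

/-- The outer product of a bounded vector field and an `L²` vector field. -/
def outerField : LpOn Ω (Fin d) ⊤ →L[ℝ] L2 Ω →L[ℝ] L2Mat Ω :=
  (outer d).holderL (volume.restrict Ω) ⊤ 2 2

lemma coeFn_mulField (g : LpOn Ω (Fin d × Fin d) ⊤) (a : L2 Ω) :
    mulField g a =ᵐ[volume.restrict Ω] fun x => matVec d (g x) (a x) :=
  (matVec d).coeFn_holder g a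

lemma coeFn_outerField (g : LpOn Ω (Fin d) ⊤) (a : L2 Ω) :
    outerField g a =ᵐ[volume.restrict Ω] fun x => outer d (g x) (a x) :=
  (outer d).coeFn_holder g a

lemma inner_mulField (g : LpOn Ω (Fin d × Fin d) ⊤) (a b : L2 Ω) :
    inner ℝ (mulField g a) b = ∫ x in Ω, ∑ i, ∑ j, g x (i, j) * a x j * b x i := by
  rw [inner_eq_integral_sum (coeFn_mulField g a) (ae_eq_refl _)]
  simp only [matVec_apply, Finset.sum_mul]

lemma inner_outerField (g : LpOn Ω (Fin d) ⊤) (a : L2 Ω) (b : L2Mat Ω) :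
    inner ℝ (outerField g a) b = ∫ x in Ω, ∑ i, ∑ j, g x i * a x j * b x (i, j) := by
  rw [inner_eq_integral_sum (coeFn_outerField g a) (ae_eq_refl _)]
  simp only [outer_apply, Fintype.sum_prod_type]

/-- The product rule for u · ∇(φ · ψ). -/
lemma inner_matVec_add_inner_outer {φ ψ : Vec d → Vec d} {x : Vec d}
    (hφ : DifferentiableAt ℝ φ x) (hψ : DifferentiableAt ℝ ψ x) (u : Vec d) :
    inner ℝ (matVec d (gradMat φ x) u) (ψ x) + inner ℝ (outer d (φ x) u) (gradMat ψ x) =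
      ∑ j, fderiv ℝ (fun x => inner ℝ (φ x) (ψ x)) x (EuclideanSpace.single j 1) * u j := by
  have e : ∀ j, fderiv ℝ (fun x => inner ℝ (φ x) (ψ x)) x (EuclideanSpace.single j 1) =
      inner ℝ (φ x) (fderiv ℝ ψ x (EuclideanSpace.single j 1)) +
        inner ℝ (fderiv ℝ φ x (EuclideanSpace.single j 1)) (ψ x) :=
    fun j => fderiv_inner_apply ℝ hφ hψ _
  simp only [e]
  simp only [PiLp.inner_apply, matVec_apply, outer_apply, Fintype.sum_prod_type, gradMat,
    RCLike.inner_apply, conj_trivial, add_mul, Finset.sum_mul, Finset.mul_sum,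
    Finset.sum_add_distrib]
  rw [add_comm]
  congr 1
  · rw [Finset.sum_comm]
    exact Finset.sum_congr rfl fun i _ => Finset.sum_congr rfl fun j _ => by ring
  · rw [Finset.sum_comm]
    exact Finset.sum_congr rfl fun i _ => Finset.sum_congr rfl fun j _ => by ring

/-- Integration by parts in the convective form: `(u · ∇φ, v) + (u · ∇v, φ) = 0`. -/
lemma inner_mulField_add_inner_outerField {φ : Vec d → Vec d}
    (hφ : IsTest Ω φ) {U : LpOn Ω (Fin d) ⊤} {g : LpOn Ω (Fin d × Fin d) ⊤}
    (hU : U =ᵐ[volume.restrict Ω] φ) (hg : g =ᵐ[volume.restrict Ω] gradMat φ)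
    (u : L2sigma Ω) {v : L2 Ω} {G : L2Mat Ω} (hv : WithLp.toLp 2 (v, G) ∈ H10 Ω) :
    inner ℝ (mulField g (u : L2 Ω)) v + inner ℝ (outerField U (u : L2 Ω)) G = 0 := by
  -- By density v may be a test field ψ; the sum is then (∇(φ · ψ), u), which vanishes because u is
  -- solenoidal.
  refine inner_eq_zero_of_mem_H1closure (fun ψ hψ v G hv hG => ?_) hv
  have hφ1 : ContDiff ℝ 1 φ := hφ.1.of_le (by exact_mod_cast le_top)
  have hψ1 : ContDiff ℝ 1 ψ := hψ.1.of_le (by exact_mod_cast le_top)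
  have hη : ContDiff ℝ 1 fun x => inner ℝ (φ x) (ψ x) := hφ1.inner ℝ hψ1
  have mz := memLp_gradScalar (Ω := Ω) hη (hφ.2.1.mono fun y hy h => hy (by simp [h])) 2
  have hx : ∀ᵐ x ∂volume.restrict Ω,
      inner ℝ (mulField g (u : L2 Ω) x) (v x) + inner ℝ (outerField U (u : L2 Ω) x) (G x) =
        ∑ j, gradScalar (fun x => inner ℝ (φ x) (ψ x)) x j * (u : L2 Ω) x j := by
    have h5 := coeFn_mulField g (u : L2 Ω)
    have h6 := coeFn_outerField U (u : L2 Ω)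
    filter_upwards [hv, hG, hU, hg, h5, h6] with x h1 h2 h3 h4 h5 h6
    simp only [h5, h6, h1, h2, h3, h4]
    exact inner_matVec_add_inner_outer ((hφ1.differentiable one_ne_zero) x)
      ((hψ1.differentiable one_ne_zero) x) _
  rw [← inner_gradient_eq_zero hη mz.coeFn_toLp u,
    inner_eq_integral_sum mz.coeFn_toLp (ae_eq_refl _), L2.inner_def, L2.inner_def,
    ← integral_add (L2.integrable_inner _ _) (L2.integrable_inner _ _)]
  exact integral_congr_ae hx

end Space

/-! ### The forms of the equation at a fixed time -/

section Static

variable {d : ℕ} {Ω : Set (Vec d)}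

lemma mem_H10sigma_of_isSolTest {φ : Vec d → Vec d} (hφ : IsSolTest Ω φ) {u : L2 Ω} {G : L2Mat Ω}
    (hu : u =ᵐ[volume.restrict Ω] φ) (hG : G =ᵐ[volume.restrict Ω] gradMat φ) :
    WithLp.toLp 2 (u, G) ∈ H10sigma Ω :=
  Submodule.le_topologicalClosure _ (Submodule.subset_span ⟨φ, hφ, hu, hG⟩)

lemma weakGrad_eq_of_mem_H10 (hΩ : IsOpen Ω) [IsFiniteMeasure (volume.restrict Ω)]
    {u : L2 Ω} {G : L2Mat Ω}
    (h : WithLp.toLp 2 (u, G) ∈ H10 Ω) : weakGrad u = G :=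
  weakGrad_eq hΩ (isWeakGrad_of_mem_H10 h)

/-- By uniqueness of the weak gradient, any G that pairs with u in H¹₀ is the one inspected by
`Force.pairing`. -/
lemma pairing_of_mem_H10 (hΩ : IsOpen Ω) [IsFiniteMeasure (volume.restrict Ω)]
    (f : Force Ω) (t : ℝ) {u : L2 Ω} {G : L2Mat Ω}
    (h : WithLp.toLp 2 (u, G) ∈ H10 Ω) :
    f.pairing t u = f.f₁ t ⟨_, h⟩ + inner ℝ (f.f₂ t) u := by
  obtain rfl := weakGrad_eq_of_mem_H10 hΩ h
  rw [Force.pairing, dif_pos h]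

lemma pairing_of_f₁_eq_zero {f : Force Ω} {t : ℝ} (h : f.f₁ t = 0) (u : L2 Ω) :
    f.pairing t u = inner ℝ (f.f₂ t) u := by
  rw [Force.pairing, h]
  split_ifs <;> simp

/-- The alternative in `hu` reflects ν = 0 versus ν > 0: without viscosity u need not lie in H¹₀,
but then the H⁻¹ part of the force is absent. -/
lemma pairing_sub (hΩ : IsOpen Ω) [IsFiniteMeasure (volume.restrict Ω)]
    {f : Force Ω} {t : ℝ} {u w : L2 Ω} {H : L2Mat Ω}
    (hu : f.f₁ t = 0 ∨ ∃ G : L2Mat Ω, WithLp.toLp 2 (u, G) ∈ H10 Ω)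
    (hw : WithLp.toLp 2 (w, H) ∈ H10 Ω) :
    f.pairing t (u - w) = f.pairing t u - f.pairing t w := by
  rcases hu with h | ⟨G, hG⟩
  · simp only [pairing_of_f₁_eq_zero h, inner_sub_right]
  · have h : WithLp.toLp 2 (u - w, G - H) ∈ H10 Ω := (H10 Ω).sub_mem hG hw
    have e : (⟨_, h⟩ : H10 Ω) = ⟨_, hG⟩ - ⟨_, hw⟩ := rfl
    have e1 : f.f₁ t ⟨_, h⟩ = f.f₁ t ⟨_, hG⟩ - f.f₁ t ⟨_, hw⟩ := by rw [e]; exact map_sub _ _ _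
    have e2 : inner ℝ (f.f₂ t) (u - w) = inner ℝ (f.f₂ t) u - inner ℝ (f.f₂ t) w :=
      inner_sub_right _ _ _
    linear_combination pairing_of_mem_H10 hΩ f t h - pairing_of_mem_H10 hΩ f t hG +
      pairing_of_mem_H10 hΩ f t hw + e1 + e2

lemma pairing_smul (hΩ : IsOpen Ω) [IsFiniteMeasure (volume.restrict Ω)]
    (f : Force Ω) (t : ℝ) {w : L2 Ω} {H : L2Mat Ω}
    (hw : WithLp.toLp 2 (w, H) ∈ H10 Ω) (α : ℝ) :
    f.pairing t (α • w) = α * f.pairing t w := by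
  have h : WithLp.toLp 2 (α • w, α • H) ∈ H10 Ω := (H10 Ω).smul_mem α hw
  have e : (⟨_, h⟩ : H10 Ω) = α • ⟨_, hw⟩ := rfl
  have e1 : f.f₁ t ⟨_, h⟩ = α * f.f₁ t ⟨_, hw⟩ := by rw [e]; exact map_smul _ _ _
  have e2 : inner ℝ (f.f₂ t) (α • w) = α * inner ℝ (f.f₂ t) w := inner_smul_right _ _ _
  linear_combination pairing_of_mem_H10 hΩ f t h - α * pairing_of_mem_H10 hΩ f t hw + e1 + e2

/-- A solenoidal test function together with its classes in the spaces on `Ω`. -/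
structure IsTestClass (φ : Vec d → Vec d) (w : L2sigma Ω) (H : L2Mat Ω)
    (U : LpOn Ω (Fin d) ⊤) (g : LpOn Ω (Fin d × Fin d) ⊤) : Prop where
  isSolTest : IsSolTest Ω φ
  w_eq : (w : L2 Ω) =ᵐ[volume.restrict Ω] φ
  H_eq : H =ᵐ[volume.restrict Ω] gradMat φ
  U_eq : U =ᵐ[volume.restrict Ω] φ
  g_eq : g =ᵐ[volume.restrict Ω] gradMat φ

/-! ### The forms evaluated at a smooth solenoidal field -/

namespace IsTestClass

variable {φ : Vec d → Vec d} {w : L2sigma Ω} {H : L2Mat Ω} {U : LpOn Ω (Fin d) ⊤}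
  {g : LpOn Ω (Fin d × Fin d) ⊤}

lemma mem_H10 (h : IsTestClass φ w H U g) : WithLp.toLp 2 ((w : L2 Ω), H) ∈ H10 Ω :=
  H10sigma_le_H10 (mem_H10sigma_of_isSolTest h.isSolTest h.w_eq h.H_eq)

lemma weakGrad_eq (h : IsTestClass φ w H U g) (hΩ : IsOpen Ω) [IsFiniteMeasure (volume.restrict Ω)]
    : weakGrad (w : L2 Ω) = H :=
  weakGrad_eq_of_mem_H10 hΩ h.mem_H10

lemma weakGrad_ae_eq (h : IsTestClass φ w H U g) (hΩ : IsOpen Ω) [IsFiniteMeasure (volume.restrict Ω)]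
    :
    weakGrad (w : L2 Ω) =ᵐ[volume.restrict Ω] g := by
  rw [h.weakGrad_eq hΩ]
  exact h.H_eq.trans h.g_eq.symm

lemma convForm_eq (h : IsTestClass φ w H U g) (hΩ : IsOpen Ω) [IsFiniteMeasure (volume.restrict Ω)]
    (a c : L2sigma Ω) :
    convForm a w c = inner ℝ (mulField g (a : L2 Ω)) (c : L2 Ω) := by
  rw [inner_mulField, convForm]
  refine integral_congr_ae ?_
  filter_upwards [h.weakGrad_ae_eq hΩ] with x hx
  simp only [hx]
  exact Finset.sum_congr rfl fun i _ => Finset.sum_congr rfl fun j _ => by ring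

lemma tensorForm_eq (h : IsTestClass φ w H U g) (hΩ : IsOpen Ω) [IsFiniteMeasure (volume.restrict Ω)]
    (a : L2sigma Ω) :
    tensorForm a w = inner ℝ (mulField g (a : L2 Ω)) (a : L2 Ω) := by
  rw [inner_mulField, tensorForm]
  refine integral_congr_ae ?_
  filter_upwards [h.weakGrad_ae_eq hΩ] with x hx
  simp only [hx]
  exact Finset.sum_congr rfl fun i _ => Finset.sum_congr rfl fun j _ => by ring

/-- A quadratic form sees only the symmetric part of its matrix. -/
lemma symForm_eq (h : IsTestClass φ w H U g) (hΩ : IsOpen Ω) [IsFiniteMeasure (volume.restrict Ω)]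
    (a : L2sigma Ω) :
    symForm a w = inner ℝ (mulField g (a : L2 Ω)) (a : L2 Ω) := by
  rw [inner_mulField, symForm]
  refine integral_congr_ae ?_
  filter_upwards [h.weakGrad_ae_eq hΩ] with x hx
  simp only [hx]
  have e : ∀ A B : Fin d → Fin d → ℝ, (∑ i, ∑ j, A i j) = (∑ i, ∑ j, B i j) →
      ∑ i, ∑ j, (1 / 2 * A i j + 1 / 2 * B i j) = ∑ i, ∑ j, A i j := by
    intro A B hAB
    simp only [Finset.sum_add_distrib, ← Finset.mul_sum]
    rw [← hAB]
    ring
  rw [← e (fun i j => g x (i, j) * (a : L2 Ω) x j * (a : L2 Ω) x i)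
    (fun i j => g x (j, i) * (a : L2 Ω) x j * (a : L2 Ω) x i)]
  · exact Finset.sum_congr rfl fun i _ => Finset.sum_congr rfl fun j _ => by ring
  · rw [Finset.sum_comm]
    exact Finset.sum_congr rfl fun i _ => Finset.sum_congr rfl fun j _ => by ring

lemma convForm_right_eq (h : IsTestClass φ w H U g) (a b : L2sigma Ω) :
    convForm a b w = inner ℝ (outerField U (a : L2 Ω)) (weakGrad (b : L2 Ω)) := by
  rw [inner_outerField, convForm]
  refine integral_congr_ae ?_
  filter_upwards [h.w_eq, h.U_eq] with x hx hx'
  simp only [hx, hx']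
  exact Finset.sum_congr rfl fun i _ => Finset.sum_congr rfl fun j _ => by ring

lemma inner_outerField_eq (h : IsTestClass φ w H U g) (u : L2sigma Ω) {v : L2 Ω} {G : L2Mat Ω}
    (hv : WithLp.toLp 2 (v, G) ∈ H10 Ω) :
    inner ℝ (outerField U (u : L2 Ω)) G = -inner ℝ (mulField g (u : L2 Ω)) v := by
  have := inner_mulField_add_inner_outerField h.isSolTest.1 h.U_eq h.g_eq u hv
  linarith

/-- `(u · ∇w, w) = 0`. -/
lemma inner_mulField_self (h : IsTestClass φ w H U g) (hΩ : IsOpen Ω) [IsFiniteMeasure (volume.restrict Ω)]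
    (u : L2sigma Ω) :
    inner ℝ (mulField g (u : L2 Ω)) (w : L2 Ω) = 0 := by
  -- The same number (u·∇w, w) is written through g and through U; integration by parts makes these
  -- opposite to each other.
  have e1 := h.inner_outerField_eq u h.mem_H10
  have e2 := h.convForm_right_eq u w
  rw [h.convForm_eq hΩ, h.weakGrad_eq hΩ] at e2
  linarith

/-- The integrand of the relative energy inequality for a smooth test function. -/
lemma relForm_add_sysOp (h : IsTestClass φ w H U g) (hΩ : IsOpen Ω) [IsFiniteMeasure (volume.restrict Ω)]
    {ν : ℝ} (hν : 0 ≤ ν)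
    {f : Force Ω} {t : ℝ} {v : L2sigma Ω}
    (hv : 0 < ν → ∃ G : L2Mat Ω, WithLp.toLp 2 ((v : L2 Ω), G) ∈ H10 Ω)
    (hf : ¬ 0 < ν → f.f₁ t = 0) (K : L2sigma Ω → ℝ≥0∞) (w' : L2sigma Ω) (ξ : ℝ) :
    relForm ν K v w + sysOp ν f t w w' (v - w) - (K w).toReal * (relEnergy v w + ξ) =
      (ν * ‖weakGrad (v : L2 Ω)‖ ^ 2 - f.pairing t v)
        - (ν * inner ℝ (weakGrad (v : L2 Ω)) (weakGrad (w : L2 Ω)) - tensorForm v w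
          - inner ℝ v w' - f.pairing t w)
        - inner ℝ w' w - (K w).toReal * ξ := by
  have hp : f.pairing t ((v - w : L2sigma Ω) : L2 Ω) = f.pairing t v - f.pairing t w := by
    refine pairing_sub hΩ ?_ h.mem_H10
    by_cases h0 : 0 < ν
    · exact Or.inr (hv h0)
    · exact Or.inl (hf h0)
  -- Because (u·∇w, w) = 0, the last slot v − w may be replaced by v.
  have e3 : ∀ u : L2sigma Ω, inner ℝ (mulField g (u : L2 Ω)) ((v - w : L2sigma Ω) : L2 Ω) =
      inner ℝ (mulField g (u : L2 Ω)) (v : L2 Ω) := by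
    intro u
    have : inner ℝ (mulField g (u : L2 Ω)) ((v - w : L2sigma Ω) : L2 Ω) =
        inner ℝ (mulField g (u : L2 Ω)) (v : L2 Ω) - inner ℝ (mulField g (u : L2 Ω)) (w : L2 Ω) :=
      inner_sub_right _ _ _
    linear_combination this - h.inner_mulField_self hΩ u
  have e4 : inner ℝ (mulField g ((v - w : L2sigma Ω) : L2 Ω)) (v : L2 Ω) =
      inner ℝ (mulField g (v : L2 Ω)) (v : L2 Ω) - inner ℝ (mulField g (w : L2 Ω)) (v : L2 Ω) := by
    have : mulField g ((v - w : L2sigma Ω) : L2 Ω) =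
      mulField g (v : L2 Ω) - mulField g (w : L2 Ω) := map_sub _ _ _
    rw [this]
    exact inner_sub_left _ _ _
  have e5 : inner ℝ w' (v - w) = inner ℝ v w' - inner ℝ w' w := by
    have : inner ℝ w' (v - w) = inner ℝ w' v - inner ℝ w' w := inner_sub_right _ _ _
    linear_combination this + real_inner_comm v w'
  have c1 := h.convForm_eq hΩ w (v - w)
  have c2 := h.tensorForm_eq hΩ v
  have c3 := e3 w
  have c4 := e3 (v - w)
  by_cases h0 : 0 < ν
  · obtain ⟨G, hG⟩ := hv h0
    have hvw : WithLp.toLp 2 (((v - w : L2sigma Ω) : L2 Ω), G - H) ∈ H10 Ω :=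
      (H10 Ω).sub_mem hG h.mem_H10
    -- With `e7` this gives ‖∇(v − w)‖² + (∇w, ∇(v − w)) = ‖∇v‖² − (∇v, ∇w).
    have e6 : ‖G - H‖ ^ 2 = ‖G‖ ^ 2 - 2 * inner ℝ G H + ‖H‖ ^ 2 := norm_sub_sq_real _ _
    have e7 : inner ℝ H (G - H) = inner ℝ G H - ‖H‖ ^ 2 := by
      have : inner ℝ H (G - H) = inner ℝ H G - inner ℝ H H := inner_sub_right _ _ _
      linear_combination this + real_inner_comm G H - real_inner_self_eq_norm_sq H
    have e8 : weakGrad ((v - w : L2sigma Ω) : L2 Ω) = G - H := weakGrad_eq_of_mem_H10 hΩ hvw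
    -- Moving the derivative onto w brings the viscous case to the quadratic form that `symForm`
    -- provides for ν = 0.
    have e9 := h.inner_outerField_eq (v - w) hvw
    have e10 : weakGrad (v : L2 Ω) = G := weakGrad_eq_of_mem_H10 hΩ hG
    have e11 := h.convForm_right_eq (v - w) (v - w)
    rw [e8] at e11
    simp only [sysOp, relForm, if_pos h0, e8, e10, h.weakGrad_eq hΩ]
    linear_combination -hp + c1 - c2 + c3 + e5 + ν * e6 + ν * e7 - e11 - e9 + c4 + e4
  · obtain rfl : ν = 0 := le_antisymm (not_lt.1 h0) hν
    have e11 := h.symForm_eq hΩ (v - w)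
    simp only [sysOp, relForm, if_neg h0]
    linear_combination -hp + c1 - c2 + c3 + e5 + e11 + c4 + e4

lemma smul (h : IsTestClass φ w H U g) (α : ℝ) :
    IsTestClass (α • φ) (α • w) (α • H) (α • U) (α • g) := by
  have hφ1 : Differentiable ℝ φ := h.isSolTest.1.1.differentiable (by simp)
  have hg : gradMat (α • φ) = α • gradMat φ := by
    funext x
    ext p
    simp [gradMat, fderiv_const_smul (hφ1 x)]
  refine ⟨⟨⟨h.isSolTest.1.1.const_smul α, h.isSolTest.1.2.1.smul_left (f := fun _ => α), ?_⟩, ?_⟩,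
    ?_, ?_, ?_, ?_⟩
  · exact (tsupport_smul_subset_right (fun _ => α) φ).trans h.isSolTest.1.2.2
  · intro x
    have := h.isSolTest.2 x
    simp only [divergence] at this ⊢
    simp [fderiv_const_smul (hφ1 x), ← Finset.mul_sum, this]
  · exact (Lp.coeFn_smul α _).trans (h.w_eq.const_smul α)
  · rw [hg]
    exact (Lp.coeFn_smul α _).trans (h.H_eq.const_smul α)
  · exact (Lp.coeFn_smul α _).trans (h.U_eq.const_smul α)
  · rw [hg]
    exact (Lp.coeFn_smul α _).trans (h.g_eq.const_smul α)

lemma weakGrad_smul (h : IsTestClass φ w H U g) (hΩ : IsOpen Ω) [IsFiniteMeasure (volume.restrict Ω)]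
    (α : ℝ) :
    weakGrad ((α • w : L2sigma Ω) : L2 Ω) = α • weakGrad (w : L2 Ω) := by
  rw [(h.smul α).weakGrad_eq hΩ, h.weakGrad_eq hΩ]

lemma tensorForm_smul (h : IsTestClass φ w H U g) (hΩ : IsOpen Ω) [IsFiniteMeasure (volume.restrict Ω)]
    (α : ℝ) (a : L2sigma Ω) :
    tensorForm a (α • w) = α * tensorForm a w := by
  rw [(h.smul α).tensorForm_eq hΩ, h.tensorForm_eq hΩ, map_smul, smul_apply,
    real_inner_smul_left]

end IsTestClass

end Static

/-! ### Curves in Lebesgue spaces given by jointly continuous functions -/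

section Curve

variable {X F : Type*} [TopologicalSpace X] [NormedAddCommGroup F]

/-- A jointly continuous family of functions with supports in a fixed compact set. -/
structure IsCompactCurve (C : Set X) (ψ : ℝ → X → F) : Prop where
  isCompact : IsCompact C
  continuous : Continuous fun p : ℝ × X => ψ p.1 p.2
  eq_zero : ∀ t, ∀ x ∉ C, ψ t x = 0

namespace IsCompactCurve

variable {C : Set X} {ψ ψ' : ℝ → X → F}

lemma continuous_apply (h : IsCompactCurve C ψ) (t : ℝ) : Continuous (ψ t) :=
  h.continuous.comp (Continuous.prodMk_right t)

lemma exists_bound (h : IsCompactCurve C ψ) (t : ℝ) : ∃ M, ∀ x, ‖ψ t x‖ ≤ M := by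
  obtain ⟨M, hM⟩ := h.isCompact.exists_bound_of_continuousOn (h.continuous_apply t).continuousOn
  refine ⟨max M 0, fun x => ?_⟩
  by_cases hx : x ∈ C
  · exact (hM x hx).trans (le_max_left _ _)
  · simp [h.eq_zero t x hx]

/-- The curve of bounded continuous functions. -/
def bcf (h : IsCompactCurve C ψ) (t : ℝ) : BoundedContinuousFunction X F :=
  BoundedContinuousFunction.ofNormedAddCommGroup (ψ t) (h.continuous_apply t)
    (h.exists_bound t).choose (h.exists_bound t).choose_spec

lemma bcf_apply (h : IsCompactCurve C ψ) (t : ℝ) (x : X) : h.bcf t x = ψ t x := rfl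

/-- Compactness of C makes continuity in time uniform in space; off C all functions vanish. -/
lemma continuous_bcf (h : IsCompactCurve C ψ) : Continuous h.bcf := by
  refine continuous_iff_continuousAt.2 fun t => Metric.tendsto_nhds.2 fun ε hε => ?_
  have : ∀ᶠ s in 𝓝 t, ∀ x ∈ C, dist (ψ s x) (ψ t x) < ε / 2 := by
    refine h.isCompact.eventually_forall_of_forall_eventually fun x _ => ?_
    have hc : Continuous fun p : ℝ × X => dist (ψ p.1 p.2) (ψ t p.2) :=
      h.continuous.dist ((h.continuous_apply t).comp continuous_snd)
    exact hc.continuousAt.eventually_lt continuousAt_const (by simpa using half_pos hε)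
  filter_upwards [this] with s hs
  refine lt_of_le_of_lt ((BoundedContinuousFunction.dist_le (half_pos hε).le).2 fun x => ?_)
    (half_lt_self hε)
  by_cases hx : x ∈ C
  · exact (hs x hx).le
  · simp only [bcf_apply, h.eq_zero _ x hx, dist_self]
    exact (half_pos hε).le

variable [NormedSpace ℝ F]

lemma hasDerivAt_bcf (h : IsCompactCurve C ψ) (h' : IsCompactCurve C ψ')
    (hd : ∀ t x, HasDerivAt (fun s => ψ s x) (ψ' t x) t) (t : ℝ) :
    HasDerivAt h.bcf (h'.bcf t) t := by
  rw [hasDerivAt_iff_isLittleO, Asymptotics.isLittleO_iff]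
  intro ε hε
  obtain ⟨δ, hδ, hb⟩ := Metric.continuousAt_iff.1 h'.continuous_bcf.continuousAt ε hε
  filter_upwards [Metric.ball_mem_nhds t hδ] with s hs
  refine (BoundedContinuousFunction.norm_le (by positivity)).2 fun x => ?_
  -- Mean value inequality for ψ(r, x) − (r − t)ψ'(t, x). Its derivative ψ'(r, x) − ψ'(t, x) is at
  -- most ε uniformly in x, since ψ' is a continuous curve in the sup norm.
  have key := (convex_ball t δ).norm_image_sub_le_of_norm_hasDerivWithin_le (C := ε)
    (f := fun r => ψ r x - (r - t) • ψ' t x) (f' := fun r => ψ' r x - ψ' t x)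
    (fun r _ => by
      have := (hd r x).sub (((hasDerivAt_id r).sub_const t).smul_const (ψ' t x))
      exact (this.congr_deriv (by simp)).hasDerivWithinAt)
    (fun r hr => by
      rw [← dist_eq_norm]
      exact (BoundedContinuousFunction.dist_coe_le_dist x).trans (hb hr).le)
    (Metric.mem_ball_self hδ) hs
  simp only [sub_self, zero_smul, sub_zero] at key
  have e : (h.bcf s - h.bcf t - (s - t) • h'.bcf t) x = ψ s x - (s - t) • ψ' t x - ψ t x := by
    change ψ s x - ψ t x - (s - t) • ψ' t x = _
    abel
  rw [e]
  exact key

variable [MeasurableSpace X] [BorelSpace X] [SecondCountableTopologyEither X F] {μ : Measure X}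
  [IsFiniteMeasure μ]

/-- On a finite measure space bounded continuous functions map continuously and linearly into L^p,
including p = ∞. -/
lemma exists_Lp (h : IsCompactCurve C ψ) (p : ℝ≥0∞) [Fact (1 ≤ p)] :
    ∃ U : ℝ → Lp F p μ, Continuous U ∧ ∀ t, U t =ᵐ[μ] ψ t :=
  ⟨fun t => BoundedContinuousFunction.toLp p μ ℝ (h.bcf t),
    (BoundedContinuousFunction.toLp p μ ℝ).continuous.comp h.continuous_bcf,
    fun t => BoundedContinuousFunction.coeFn_toLp p μ ℝ (h.bcf t)⟩

lemma hasDerivAt_Lp (h : IsCompactCurve C ψ) (h' : IsCompactCurve C ψ')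
    (hd : ∀ t x, HasDerivAt (fun s => ψ s x) (ψ' t x) t) {p : ℝ≥0∞} [Fact (1 ≤ p)]
    {U U' : ℝ → Lp F p μ} (hU : ∀ t, U t =ᵐ[μ] ψ t) (hU' : ∀ t, U' t =ᵐ[μ] ψ' t) (t : ℝ) :
    HasDerivAt U (U' t) t := by
  have e : U = fun t => BoundedContinuousFunction.toLp p μ ℝ (h.bcf t) := by
    funext s
    exact Lp.ext ((hU s).trans (BoundedContinuousFunction.coeFn_toLp p μ ℝ (h.bcf s)).symm)
  have e' : U' t = BoundedContinuousFunction.toLp p μ ℝ (h'.bcf t) :=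
    Lp.ext ((hU' t).trans (BoundedContinuousFunction.coeFn_toLp p μ ℝ (h'.bcf t)).symm)
  rw [e, e']
  exact (BoundedContinuousFunction.toLp p μ ℝ).hasFDerivAt.comp_hasDerivAt t
    (h.hasDerivAt_bcf h' hd t)

end IsCompactCurve

end Curve

/-! ### Smooth test functions in time and space -/

instance (T : ℝ) : IsFiniteMeasure (timeMeasure T) :=
  inferInstanceAs (IsFiniteMeasure (volume.restrict (Set.Ioo 0 T)))

lemma memLp_timeMeasure_of_continuous {E : Type*} [NormedAddCommGroup E] {u : ℝ → E}
    (h : Continuous u) (p : ℝ≥0∞) (T : ℝ) : MemLp u p (timeMeasure T) := by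
  obtain ⟨M, hM⟩ := (isCompact_Icc (a := 0) (b := T)).exists_bound_of_continuousOn h.continuousOn
  have htop : MemLp u ⊤ (timeMeasure T) := by
    refine memLp_top_of_bound h.aestronglyMeasurable M ?_
    filter_upwards [ae_restrict_mem measurableSet_Ioo] with t ht
    exact hM t ⟨ht.1.le, ht.2.le⟩
  exact htop.mono_exponent le_top

section C1

variable {d : ℕ} {Ω : Set (Vec d)} {φ : ℝ → Vec d → Vec d}

namespace IsC1Test

lemma hasDerivAt (h : IsC1Test Ω φ) (t : ℝ) (x : Vec d) :
    HasDerivAt (fun s => φ s x) (deriv (fun s => φ s x) t) t :=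
  (h.differentiable x t).hasDerivAt

/-- Two spatial derivatives are enough: the first for W^{1,∞} and H¹, the second for the H² part of
𝕐. -/
lemma exists_compact (h : IsC1Test Ω φ) :
    ∃ C : Set (Vec d), C ⊆ Ω ∧ IsCompactCurve C φ ∧
      IsCompactCurve C (fun t x => deriv (fun s => φ s x) t) ∧
      IsCompactCurve C (fun t => gradMat (φ t)) ∧
      IsCompactCurve C (fun t => gradField (gradMat (φ t))) := by
  obtain ⟨C, hC, hCΩ, h0⟩ := h.support
  have ht : ∀ t, tsupport (φ t) ⊆ C := fun t =>
    closure_minimal (fun x hx => by_contra fun hxC => hx (h0 t x hxC)) hC.isClosed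
  have hg0 : ∀ t, ∀ x ∉ C, gradMat (φ t) x = 0 := fun t x hx =>
    gradField_eq_zero fun hx' => hx (ht t hx')
  have htg : ∀ t, tsupport (gradMat (φ t)) ⊆ C := fun t =>
    closure_minimal (fun x hx => by_contra fun hxC => hx (hg0 t x hxC)) hC.isClosed
  refine ⟨C, hCΩ, ⟨hC, ?_, h0⟩, ⟨hC, ?_, fun t x hx => ?_⟩, ⟨hC, ?_, hg0⟩, ⟨hC, ?_, fun t x hx =>
    gradField_eq_zero fun hx' => hx (htg t hx')⟩⟩
  · have := (ContinuousMultilinearMap.apply ℝ (fun _ : Fin 0 => Vec d) (Vec d) 0).continuous.comp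
      (h.continuous 0)
    simpa [Function.comp_def] using this
  · have := (ContinuousMultilinearMap.apply ℝ (fun _ : Fin 0 => Vec d) (Vec d) 0).continuous.comp
      (h.continuous_deriv 0)
    simpa [Function.comp_def] using this
  · simp [h0 _ x hx]
  · refine (PiLp.continuous_toLp 2 _).comp (continuous_pi fun p => ?_)
    have := (ContinuousMultilinearMap.apply ℝ (fun _ : Fin 1 => Vec d) (Vec d)
      fun _ => EuclideanSpace.single p.2 1).continuous.comp (h.continuous 1)
    have h2 := (EuclideanSpace.proj (𝕜 := ℝ) p.1).continuous.comp this
    simpa [Function.comp_def, iteratedFDeriv_one_apply] using h2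
  · refine (PiLp.continuous_toLp 2 _).comp (continuous_pi fun p => ?_)
    -- The outer derivative direction `p.2` fills the first slot of `iteratedFDeriv`, the inner
    -- direction `p.1.2` the second.
    have := (ContinuousMultilinearMap.apply ℝ (fun _ : Fin 2 => Vec d) (Vec d)
      ![EuclideanSpace.single p.2 1, EuclideanSpace.single p.1.2 1]).continuous.comp
        (h.continuous 2)
    have h2 := (EuclideanSpace.proj (𝕜 := ℝ) p.1.1).continuous.comp this
    convert h2 using 2 with q
    have hd : DifferentiableAt ℝ (fderiv ℝ (φ q.1)) q.2 :=
      ((h.smooth q.1).fderiv_right (m := 1) (by norm_cast)).differentiable one_ne_zero q.2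
    have hg : DifferentiableAt ℝ (gradMat (φ q.1)) q.2 := by
      refine differentiableAt_euclidean.2 fun i => ?_
      exact (EuclideanSpace.proj (𝕜 := ℝ) i.1).differentiableAt.comp _
        (hd.clm_apply (differentiableAt_const _))
    rw [← fderiv_coord hg]
    have e : (fun y => gradMat (φ q.1) y p.1) = (EuclideanSpace.proj (𝕜 := ℝ) p.1.1) ∘
        fun y => fderiv ℝ (φ q.1) y (EuclideanSpace.single p.1.2 1) := rfl
    rw [e, fderiv_comp _ (EuclideanSpace.proj (𝕜 := ℝ) p.1.1).differentiableAt
      (hd.clm_apply (differentiableAt_const _)), ContinuousLinearMap.fderiv,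
      fderiv_clm_apply hd (differentiableAt_const _)]
    simp [iteratedFDeriv_two_apply]

lemma isSolTest (h : IsC1Test Ω φ) (t : ℝ) : IsSolTest Ω (φ t) := by
  obtain ⟨C, hC, hCΩ, h0⟩ := h.support
  have ht : tsupport (φ t) ⊆ C :=
    closure_minimal (fun x hx => by_contra fun hxC => hx (h0 t x hxC)) hC.isClosed
  exact ⟨⟨h.smooth t, HasCompactSupport.intro hC (h0 t), ht.trans hCΩ⟩, h.solenoidal t⟩

lemma const_smul (h : IsC1Test Ω φ) (α : ℝ) : IsC1Test Ω (α • φ) := by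
  obtain ⟨C, hC, hCΩ, h0⟩ := h.support
  have hd : ∀ x t, deriv (fun τ => (α • φ) τ x) t = α • deriv (fun τ => φ τ x) t := fun x t =>
    deriv_fun_const_smul α (h.differentiable x t)
  refine ⟨⟨C, hC, hCΩ, fun t x hx => by simp [h0 t x hx]⟩, fun t => (h.smooth t).const_smul α, ?_,
    fun x => (h.differentiable x).const_smul α, fun t => ?_, fun n => ?_, fun n => ?_⟩
  · intro t x
    have := h.solenoidal t x
    simp only [divergence, Pi.smul_apply] at this ⊢
    simp [fderiv_const_smul (((h.smooth t).differentiable (by simp)) x), ← Finset.mul_sum, this]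
  · simp only [hd]
    exact (h.smooth_deriv t).const_smul α
  · have e : ∀ p : ℝ × Vec d, iteratedFDeriv ℝ n ((α • φ) p.1) p.2 =
        α • iteratedFDeriv ℝ n (φ p.1) p.2 := fun p => by
      have hn : ContDiff ℝ n (φ p.1) := (h.smooth p.1).of_le (by exact_mod_cast le_top)
      exact iteratedFDeriv_const_smul_apply (a := α) hn.contDiffAt
    simp only [e]
    exact (h.continuous n).const_smul α
  · have e : ∀ p : ℝ × Vec d, iteratedFDeriv ℝ n (fun x => deriv (fun τ => (α • φ) τ x) p.1) p.2 =
        α • iteratedFDeriv ℝ n (fun x => deriv (fun τ => φ τ x) p.1) p.2 := fun p => by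
      simp only [hd]
      have hn : ContDiff ℝ n fun x => deriv (fun τ => φ τ x) p.1 :=
        (h.smooth_deriv p.1).of_le (by exact_mod_cast le_top)
      exact iteratedFDeriv_const_smul_apply (a := α) hn.contDiffAt
    simp only [e]
    exact (h.continuous_deriv n).const_smul α

end IsC1Test

/-- A solenoidal `C¹` test function together with the continuous curves of its classes. -/
structure IsTestCurve (φ : ℝ → Vec d → Vec d) (w w' : ℝ → L2sigma Ω) (H : ℝ → L2Mat Ω)
    (U : ℝ → LpOn Ω (Fin d) ⊤) (g : ℝ → LpOn Ω (Fin d × Fin d) ⊤) : Prop where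
  isC1Test : IsC1Test Ω φ
  isTestClass : ∀ t, IsTestClass (φ t) (w t) (H t) (U t) (g t)
  deriv_eq : ∀ t, (w' t : L2 Ω) =ᵐ[volume.restrict Ω] fun x => deriv (fun s => φ s x) t
  hasDerivAt : ∀ t, HasDerivAt w (w' t) t
  continuous_deriv : Continuous w'
  continuous_H : Continuous H
  continuous_U : Continuous U
  continuous_g : Continuous g

lemma IsC1Test.exists_isTestCurve [IsFiniteMeasure (volume.restrict Ω)]
    (h : IsC1Test Ω φ) {w : ℝ → L2sigma Ω}
    (hw : ∀ t, (w t : L2 Ω) =ᵐ[volume.restrict Ω] φ t) :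
    ∃ w' H U g, IsTestCurve φ w w' H U g := by
  obtain ⟨C, -, c0, c', cg, -⟩ := h.exists_compact
  obtain ⟨U, hUc, hU⟩ := c0.exists_Lp (μ := volume.restrict Ω) ⊤
  obtain ⟨g, hgc, hg⟩ := cg.exists_Lp (μ := volume.restrict Ω) ⊤
  obtain ⟨H, hHc, hH⟩ := cg.exists_Lp (μ := volume.restrict Ω) 2
  obtain ⟨D, hDc, hD⟩ := c'.exists_Lp (μ := volume.restrict Ω) 2
  have hder : ∀ t, HasDerivAt (fun s => (w s : L2 Ω)) (D t) t :=
    c0.hasDerivAt_Lp c' h.hasDerivAt hw hD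
  -- The time derivative is a limit of difference quotients, which stay in a closed subspace.
  have hmem : ∀ t, D t ∈ L2sigma Ω := by
    intro t
    have hcl : IsClosed (L2sigma Ω : Set (L2 Ω)) := Submodule.isClosed_topologicalClosure _
    refine hcl.mem_of_tendsto (hder t).tendsto_slope (Eventually.of_forall fun s => ?_)
    rw [slope_def_module]
    exact (L2sigma Ω).smul_mem _ ((L2sigma Ω).sub_mem (w s).2 (w t).2)
  refine ⟨fun t => ⟨D t, hmem t⟩, H, U, g, h, fun t => ⟨h.isSolTest t, hw t, hH t, hU t, hg t⟩, hD,
    fun t => ?_, hDc.subtype_mk _, hHc, hUc, hgc⟩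
  -- The subspace carries the norm of L², so differentiability there is the same estimate on the
  -- remainder.
  have := hder t
  rw [hasDerivAt_iff_isLittleO] at this ⊢
  rw [← Asymptotics.isLittleO_norm_left] at this ⊢
  exact this

namespace IsTestCurve

variable {w w' : ℝ → L2sigma Ω} {H : ℝ → L2Mat Ω} {U : ℝ → LpOn Ω (Fin d) ⊤}
    {g : ℝ → LpOn Ω (Fin d × Fin d) ⊤}

lemma continuous (h : IsTestCurve φ w w' H U g) : Continuous w :=
  continuous_iff_continuousAt.2 fun t => (h.hasDerivAt t).continuousAt

lemma memX (h : IsTestCurve φ w w' H U g) (ν T : ℝ) : MemX ν T w :=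
  ⟨memLp_timeMeasure_of_continuous h.continuous ⊤ T, fun _ =>
    ⟨H, memLp_timeMeasure_of_continuous h.continuous_H 2 T, Eventually.of_forall fun t =>
      mem_H10sigma_of_isSolTest (h.isTestClass t).isSolTest (h.isTestClass t).w_eq
        (h.isTestClass t).H_eq⟩⟩

lemma hasL2TimeDeriv (h : IsTestCurve φ w w' H U g) (T : ℝ) : HasL2TimeDeriv T w w' := by
  refine ⟨memLp_timeMeasure_of_continuous h.continuous 2 T,
    memLp_timeMeasure_of_continuous h.continuous_deriv 2 T, fun η hη => ?_⟩
  have hη1 : ContDiff ℝ 1 η := hη.1.of_le (by exact_mod_cast le_top)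
  have cη' : Continuous (deriv η) := hη1.continuous_deriv le_rfl
  have c1 : Continuous fun t => deriv η t • w t := cη'.smul h.continuous
  have c2 : Continuous fun t => η t • w' t := hη1.continuous.smul h.continuous_deriv
  have s1 : HasCompactSupport fun t => deriv η t • w t := hη.2.1.deriv.smul_right
  have s2 : HasCompactSupport fun t => η t • w' t := hη.2.1.smul_right
  have i1 := c1.integrable_of_hasCompactSupport (μ := volume) s1
  have i2 := c2.integrable_of_hasCompactSupport (μ := volume) s2
  have i3 : Integrable fun t => η t • w t :=
    (hη1.continuous.smul h.continuous).integrable_of_hasCompactSupport hη.2.1.smul_right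
  -- The derivative of the compactly supported curve ηw has integral zero over ℝ.
  have key := integral_eq_zero_of_hasDerivAt_of_integrable
    (f := fun t => η t • w t) (f' := fun t => η t • w' t + deriv η t • w t)
    (fun t => ((hη1.differentiable one_ne_zero) t).hasDerivAt.smul (h.hasDerivAt t))
    (i2.add i1) i3
  rw [integral_add i2 i1] at key
  rw [timeMeasure, setIntegral_eq_integral_of_forall_compl_eq_zero,
    setIntegral_eq_integral_of_forall_compl_eq_zero]
  · exact eq_neg_of_add_eq_zero_right key
  · intro t ht
    simp [image_eq_zero_of_notMem_tsupport fun h' => ht (hη.2.2 h')]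
  · intro t ht
    have : deriv η t = 0 := by
      by_contra h0
      exact ht (hη.2.2 (support_deriv_subset h0))
    simp [this]

lemma memY [IsFiniteMeasure (volume.restrict Ω)]
    (h : IsTestCurve φ w w' H U g) (ν T : ℝ) : MemY ν T w w' := by
  have hC1 : ∀ t, ContDiff ℝ 1 (φ t) := fun t =>
    (h.isC1Test.smooth t).of_le (by exact_mod_cast le_top)
  obtain ⟨C, -, -, -, -, cH⟩ := h.isC1Test.exists_compact
  obtain ⟨V, hVc, hV⟩ := cH.exists_Lp (μ := volume.restrict Ω) 2
  refine ⟨h.memX ν T, ⟨U, g, memLp_timeMeasure_of_continuous h.continuous_U 1 T,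
    memLp_timeMeasure_of_continuous h.continuous_g 1 T, Eventually.of_forall fun t => ⟨?_, ?_⟩⟩,
    h.hasL2TimeDeriv T, fun _ => ⟨memLp_timeMeasure_of_continuous h.continuous 2 T, H, V,
      memLp_timeMeasure_of_continuous h.continuous_H 2 T,
      memLp_timeMeasure_of_continuous hVc 2 T, Eventually.of_forall fun t => ⟨?_, ?_⟩⟩⟩
  · exact (h.isTestClass t).w_eq.trans (h.isTestClass t).U_eq.symm
  · exact (isWeakGrad_gradField (hC1 t)).congr (h.isTestClass t).U_eq.symm
      (h.isTestClass t).g_eq.symm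
  · exact (isWeakGrad_gradField (hC1 t)).congr (h.isTestClass t).w_eq.symm
      (h.isTestClass t).H_eq.symm
  · have hg : ContDiff ℝ 1 (gradMat (φ t)) := by
      refine contDiff_euclidean.2 fun i => ?_
      have hd : ContDiff ℝ 1 (fderiv ℝ (φ t)) :=
        (h.isC1Test.smooth t).fderiv_right (by norm_cast)
      exact (EuclideanSpace.proj (𝕜 := ℝ) i.1).contDiff.comp (hd.clm_apply contDiff_const)
    exact (isWeakGrad_gradField hg).congr (h.isTestClass t).H_eq.symm (hV t).symm

lemma smul (h : IsTestCurve φ w w' H U g) (α : ℝ) :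
    IsTestCurve (α • φ) (α • w) (α • w') (α • H) (α • U) (α • g) := by
  refine ⟨h.isC1Test.const_smul α, fun t => (h.isTestClass t).smul α, fun t => ?_,
    fun t => (h.hasDerivAt t).const_smul α, h.continuous_deriv.const_smul α,
    h.continuous_H.const_smul α, h.continuous_U.const_smul α, h.continuous_g.const_smul α⟩
  have hd : (fun x => deriv (fun τ => (α • φ) τ x) t) = α • fun x => deriv (fun τ => φ τ x) t :=
    funext fun x => deriv_fun_const_smul α (h.isC1Test.differentiable x t)
  rw [hd]
  exact (Lp.coeFn_smul α _).trans ((h.deriv_eq t).const_smul α)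

end IsTestCurve

end C1

/-! ### Integrability in time -/

section Time

variable {d : ℕ} {Ω : Set (Vec d)} {ν T : ℝ} {f : Force Ω} {v : ℝ → L2sigma Ω}

lemma _root_.MeasureTheory.Integrable.intervalIntegrable_of_timeMeasure {h : ℝ → ℝ}
    (hh : Integrable h (timeMeasure T)) {q r : ℝ} (hq : 0 < q) (hqr : q ≤ r) (hr : r < T) :
    IntervalIntegrable h volume q r := by
  rw [intervalIntegrable_iff_integrableOn_Ioc_of_le hqr]
  exact IntegrableOn.mono_set hh fun x hx => ⟨hq.trans hx.1, hx.2.trans_lt hr⟩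

lemma integrable_inner_of_memLp {α E : Type*} [MeasurableSpace α] {μ : Measure α}
    [NormedAddCommGroup E] [InnerProductSpace ℝ E] {a b : α → E} {p q : ℝ≥0∞}
    [ENNReal.HolderTriple p q 1] (ha : MemLp a p μ) (hb : MemLp b q μ) :
    Integrable (fun t => (inner ℝ (a t) (b t) : ℝ)) μ :=
  memLp_one_iff_integrable.1 ((innerSL ℝ).memLp_of_bilin 1 ha hb)

lemma integrable_clm_apply {α E : Type*} [MeasurableSpace α] {μ : Measure α}
    [NormedAddCommGroup E] [NormedSpace ℝ E] {L : α → StrongDual ℝ E} {z : α → E}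
    (hL : MemLp L 2 μ) (hz : MemLp z 2 μ) : Integrable (fun t => L t (z t)) μ :=
  memLp_one_iff_integrable.1
    ((ContinuousLinearMap.id ℝ (StrongDual ℝ E)).memLp_of_bilin (E := StrongDual ℝ E) (p := 2)
      (q := 2) 1 hL hz)

lemma MemX.memLp_coe (h : MemX ν T v) : MemLp (fun t => (v t : L2 Ω)) ⊤ (timeMeasure T) :=
  (L2sigma Ω).subtypeL.comp_memLp' h.1

lemma MemX.memLp_two (h : MemX ν T v) : MemLp (fun t => (v t : L2 Ω)) 2 (timeMeasure T) :=
  h.memLp_coe.mono_exponent le_top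

lemma integrable_pairing (hΩ : IsOpen Ω) [IsFiniteMeasure (volume.restrict Ω)]
    (hf : MemZ ν T f) (hv : MemX ν T v) :
    Integrable (fun t => f.pairing t (v t)) (timeMeasure T) := by
  have i2 : Integrable (fun t => (inner ℝ (f.f₂ t) (v t : L2 Ω) : ℝ)) (timeMeasure T) :=
    integrable_inner_of_memLp (p := 1) (q := ⊤) hf.1 hv.memLp_coe
  by_cases h0 : 0 < ν
  · obtain ⟨G, hG, hmem⟩ := hv.2 h0
    have : CompleteSpace (H10 Ω) := Submodule.topologicalClosure.completeSpace _
    have mZ : MemLp (fun t => WithLp.toLp 2 ((v t : L2 Ω), G t)) 2 (timeMeasure T) :=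
      MemLp.of_fst_of_snd_prodLp ⟨hv.memLp_two, hG⟩
    -- `f₁` acts on the subtype H¹₀, where (v, G) lies only for almost every time. Projecting gives
    -- a curve in H¹₀ at all times without changing it almost everywhere.
    have mP := (H10 Ω).orthogonalProjectionOnto.comp_memLp' mZ
    have i1 := integrable_clm_apply (hf.2.1 h0) mP
    refine (i1.add i2).congr ?_
    filter_upwards [hmem] with t ht
    have ht' := H10sigma_le_H10 ht
    have hP : (H10 Ω).orthogonalProjectionOnto (WithLp.toLp 2 ((v t : L2 Ω), G t)) = ⟨_, ht'⟩ :=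
      Submodule.orthogonalProjectionOnto_mem_subspace_eq_self (⟨_, ht'⟩ : H10 Ω)
    simp only [Pi.add_apply, Function.comp_apply, hP]
    exact (pairing_of_mem_H10 hΩ f t ht').symm
  · refine i2.congr ?_
    filter_upwards [hf.2.2 h0] with t ht
    exact (pairing_of_f₁_eq_zero ht _).symm

/-- For `ν > 0` the weak gradient of `v ∈ 𝕏` is square integrable in time. -/
lemma MemX.memLp_weakGrad (hΩ : IsOpen Ω) [IsFiniteMeasure (volume.restrict Ω)]
    (hv : MemX ν T v) (h0 : 0 < ν) :
    MemLp (fun t => weakGrad (v t : L2 Ω)) 2 (timeMeasure T) := by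
  obtain ⟨G, hG, hmem⟩ := hv.2 h0
  refine hG.ae_eq ?_
  filter_upwards [hmem] with t ht
  exact (weakGrad_eq_of_mem_H10 hΩ (H10sigma_le_H10 ht)).symm

lemma integrable_dissipation (hΩ : IsOpen Ω) [IsFiniteMeasure (volume.restrict Ω)] (hν : 0 ≤ ν)
    (hf : MemZ ν T f) (hv : MemX ν T v) :
    Integrable (dissipation ν f v) (timeMeasure T) := by
  have i1 : Integrable (fun t => ν * ‖weakGrad (v t : L2 Ω)‖ ^ 2) (timeMeasure T) := by
    rcases hν.eq_or_lt with rfl | h0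
    · simp
    · exact ((hv.memLp_weakGrad hΩ h0).integrable_norm_pow two_ne_zero).const_mul ν
  exact i1.sub (integrable_pairing hΩ hf hv)

namespace IsTestCurve

variable {φ : ℝ → Vec d → Vec d} {w w' : ℝ → L2sigma Ω} {H : ℝ → L2Mat Ω}
  {U : ℝ → LpOn Ω (Fin d) ⊤} {g : ℝ → LpOn Ω (Fin d × Fin d) ⊤}

lemma residual_eq (h : IsTestCurve φ w w' H U g) (ν : ℝ) (f : Force Ω) (v : ℝ → L2sigma Ω)
    (t : ℝ) : residual ν f v φ w t =
      ν * inner ℝ (weakGrad (v t : L2 Ω)) (weakGrad (w t : L2 Ω)) - tensorForm (v t) (w t)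
        - inner ℝ (v t) (w' t) - f.pairing t (w t) := by
  have e : (∫ x in Ω, inner ℝ ((v t : L2 Ω) x) (deriv (fun τ => φ τ x) t)) =
      inner ℝ (v t) (w' t) := by
    rw [Submodule.coe_inner, L2.inner_def]
    refine integral_congr_ae ?_
    filter_upwards [h.deriv_eq t] with x hx
    rw [hx]
  rw [residual, e]

/-- Linearity in the test field is not automatic, because `weakGrad` and `Force.pairing` are not
linear by definition; membership of test fields in H¹₀ supplies it. -/
lemma residual_smul (h : IsTestCurve φ w w' H U g) (hΩ : IsOpen Ω)
    [IsFiniteMeasure (volume.restrict Ω)] (ν : ℝ) (f : Force Ω) (v : ℝ → L2sigma Ω) (α t : ℝ) :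
    residual ν f v (α • φ) (α • w) t = α * residual ν f v φ w t := by
  have h1 := (h.smul α).residual_eq ν f v t
  have h2 := h.residual_eq ν f v t
  simp only [Pi.smul_apply, (h.isTestClass t).weakGrad_smul hΩ,
    (h.isTestClass t).tensorForm_smul hΩ] at h1
  have e1 : inner ℝ (weakGrad (v t : L2 Ω)) (α • weakGrad (w t : L2 Ω)) =
      α * inner ℝ (weakGrad (v t : L2 Ω)) (weakGrad (w t : L2 Ω)) := inner_smul_right _ _ _
  have e2 : inner ℝ (v t) (α • w' t) = α * inner ℝ (v t) (w' t) :=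
    real_inner_smul_right (F := L2sigma Ω) (v t) (w' t) α
  have e3 : f.pairing t ((α • w t : L2sigma Ω) : L2 Ω) = α * f.pairing t (w t) :=
    pairing_smul hΩ f t (h.isTestClass t).mem_H10 α
  linear_combination h1 - α * h2 + ν * e1 - e2 - e3

lemma residual_eq_zero (h : IsTestCurve φ w w' H U g) (hΩ : IsOpen Ω)
    [IsFiniteMeasure (volume.restrict Ω)] (ν : ℝ) (f : Force Ω) (v : ℝ → L2sigma Ω) {t : ℝ}
    (hw : w t = 0) (hw' : w' t = 0) : residual ν f v φ w t = 0 := by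
  have h2 := h.residual_eq ν f v t
  -- Scaling by 0 shows that each form vanishes at the zero field.
  have e1 := (h.isTestClass t).weakGrad_smul hΩ 0
  have e2 := (h.isTestClass t).tensorForm_smul hΩ 0 (v t)
  have e3 := pairing_smul hΩ f t (h.isTestClass t).mem_H10 0
  simp only [hw, smul_zero, zero_smul, Submodule.coe_zero, zero_mul] at e1 e2 e3
  simp only [hw, hw', Submodule.coe_zero, e1, e2, e3, inner_zero_right] at h2
  rw [h2]
  ring

lemma integrable_residual (h : IsTestCurve φ w w' H U g) (hΩ : IsOpen Ω)
    [IsFiniteMeasure (volume.restrict Ω)] (hν : 0 ≤ ν) (hf : MemZ ν T f) (hv : MemX ν T v) :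
    Integrable (residual ν f v φ w) (timeMeasure T) := by
  have i1 : Integrable (fun t => ν * inner ℝ (weakGrad (v t : L2 Ω)) (weakGrad (w t : L2 Ω)))
      (timeMeasure T) := by
    rcases hν.eq_or_lt with rfl | h0
    · simp
    · exact (integrable_inner_of_memLp (p := 2) (q := 2) (hv.memLp_weakGrad hΩ h0)
        ((h.memX ν T).memLp_weakGrad hΩ h0)).const_mul ν
  have i2 : Integrable (fun t => tensorForm (v t) (w t)) (timeMeasure T) := by
    -- Hölder in time with exponents ∞ for ∇w and 2 for v.
    have m : MemLp (fun t => mulField (g t) (v t : L2 Ω)) 2 (timeMeasure T) :=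
      mulField.memLp_of_bilin 2 (memLp_timeMeasure_of_continuous h.continuous_g ⊤ T) hv.memLp_two
    simp only [(h.isTestClass _).tensorForm_eq hΩ]
    exact integrable_inner_of_memLp (p := 2) (q := 2) m hv.memLp_two
  have i3 : Integrable (fun t => (inner ℝ (v t) (w' t) : ℝ)) (timeMeasure T) :=
    integrable_inner_of_memLp (p := ⊤) (q := 1) hv.1
      (memLp_timeMeasure_of_continuous h.continuous_deriv 1 T)
  refine (((i1.sub i2).sub i3).sub (integrable_pairing hΩ hf (h.memX ν T))).congr
    (.of_forall fun t => ?_)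
  simp only [Pi.sub_apply]
  exact (h.residual_eq ν f v t).symm

lemma mem_domK (h : IsTestCurve φ w w' H U g) {K : L2sigma Ω → ℝ≥0∞} (hK : IsAdmissible ν T K) :
    w ∈ domK ν T K :=
  hK.c1_mem w ⟨φ, h.isC1Test, fun t _ => (h.isTestClass t).w_eq⟩

end IsTestCurve

lemma integrable_toReal_mul {K : L2sigma Ω → ℝ≥0∞} {w : ℝ → L2sigma Ω} (hw : w ∈ domK ν T K)
    {ξ : ℝ → ℝ} (hξ : MemLp ξ ⊤ (timeMeasure T)) :
    Integrable (fun t => (K (w t)).toReal * ξ t) (timeMeasure T) := by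
  have i := integrable_toReal_of_lintegral_ne_top hw.2.1 hw.2.2
  exact memLp_one_iff_integrable.1 ((ContinuousLinearMap.mul ℝ ℝ).memLp_of_bilin 1
    (memLp_one_iff_integrable.2 i) hξ)

/-! ### The inequalities -/

lemma relEnergy_zero_right (u : L2sigma Ω) : relEnergy u 0 = 1 / 2 * ‖u‖ ^ 2 := by
  rw [relEnergy, sub_zero]

/-- The relative energy inequality for smooth solenoidal test functions, at times where the test
function vanishes. -/
lemma IsEnergyVariationalSolution.inequality_of_isTestCurve (hΩ : IsOpen Ω)
    [IsFiniteMeasure (volume.restrict Ω)] (hν : 0 ≤ ν) (hf : MemZ ν T f) {v₀ : L2sigma Ω}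
    {ξ : ℝ → ℝ} (hsol : IsEnergyVariationalSolution ν T f v₀ v ξ) {K : L2sigma Ω → ℝ≥0∞}
    (hK : IsAdmissible ν T K) {φ : ℝ → Vec d → Vec d} {w w' : ℝ → L2sigma Ω} {H : ℝ → L2Mat Ω}
    {U : ℝ → LpOn Ω (Fin d) ⊤} {g : ℝ → LpOn Ω (Fin d × Fin d) ⊤}
    (h : IsTestCurve φ w w' H U g) :
    ∀ᵐ q ∂timeMeasure T, ∀ᵐ r ∂timeMeasure T, q < r → w q = 0 → w r = 0 →
      totalEnergy v ξ r - totalEnergy v ξ q + ((∫ τ in q..r, dissipation ν f v τ)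
        - (∫ τ in q..r, residual ν f v φ w τ) - ∫ τ in q..r, (K (w τ)).toReal * ξ τ) ≤ 0 := by
  have hae : ∀ᵐ τ ∂timeMeasure T,
      relForm ν K (v τ) (w τ) + sysOp ν f τ (w τ) (w' τ) (v τ - w τ)
        - (K (w τ)).toReal * (relEnergy (v τ) (w τ) + ξ τ) =
      dissipation ν f v τ - residual ν f v φ w τ - inner ℝ (w' τ) (w τ)
        - (K (w τ)).toReal * ξ τ := by
    have h1 : ∀ᵐ τ ∂timeMeasure T, 0 < ν →
        ∃ G : L2Mat Ω, WithLp.toLp 2 ((v τ : L2 Ω), G) ∈ H10 Ω := by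
      by_cases h0 : 0 < ν
      · obtain ⟨G, -, hG⟩ := hsol.memX.2 h0
        filter_upwards [hG] with τ hτ _
        exact ⟨G τ, H10sigma_le_H10 hτ⟩
      · exact .of_forall fun τ h => absurd h h0
    have h2 : ∀ᵐ τ ∂timeMeasure T, ¬ 0 < ν → f.f₁ τ = 0 := by
      by_cases h0 : 0 < ν
      · exact .of_forall fun τ h => absurd h0 h
      · filter_upwards [hf.2.2 h0] with τ hτ _
        exact hτ
    filter_upwards [h1, h2] with τ h1 h2
    rw [h.residual_eq, dissipation]
    exact (h.isTestClass τ).relForm_add_sysOp hΩ hν h1 h2 K (w' τ) (ξ τ)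
  have cw : Continuous fun τ => (inner ℝ (w' τ) (w τ) : ℝ) := h.continuous_deriv.inner h.continuous
  filter_upwards [hsol.relative_energy K hK w w' (h.memY ν T) (h.mem_domK hK),
    ae_restrict_mem measurableSet_Ioo] with q hq hqT
  filter_upwards [hq, ae_restrict_mem measurableSet_Ioo] with r hr hrT hqr hwq hwr
  have hint : ∫ τ in q..r, (relForm ν K (v τ) (w τ) + sysOp ν f τ (w τ) (w' τ) (v τ - w τ)
        - (K (w τ)).toReal * (relEnergy (v τ) (w τ) + ξ τ)) =
      ∫ τ in q..r, (dissipation ν f v τ - residual ν f v φ w τ - inner ℝ (w' τ) (w τ)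
        - (K (w τ)).toReal * ξ τ) := by
    refine intervalIntegral.integral_congr_ae ?_
    filter_upwards [(ae_restrict_iff' measurableSet_Ioo).1 hae] with τ hτ hτqr
    rw [Set.uIoc_of_le hqr.le] at hτqr
    exact hτ ⟨hqT.1.trans hτqr.1, hτqr.2.trans_lt hrT.2⟩
  have iD := (integrable_dissipation hΩ hν hf hsol.memX).intervalIntegrable_of_timeMeasure
    hqT.1 hqr.le hrT.2
  have iR := (h.integrable_residual hΩ hν hf hsol.memX).intervalIntegrable_of_timeMeasure
    hqT.1 hqr.le hrT.2
  have iK := (integrable_toReal_mul (h.mem_domK hK)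
    hsol.memLp_xi).intervalIntegrable_of_timeMeasure hqT.1 hqr.le hrT.2
  have iw : IntervalIntegrable (fun τ => (inner ℝ (w' τ) (w τ) : ℝ)) volume q r :=
    cw.intervalIntegrable q r
  -- The only term quadratic in w is an exact derivative, and w vanishes at both ends.
  have hzero : ∫ τ in q..r, (inner ℝ (w' τ) (w τ) : ℝ) = 0 := by
    have hd : ∀ τ, HasDerivAt (fun τ => 1 / 2 * ‖w τ‖ ^ 2) (inner ℝ (w' τ) (w τ)) τ := by
      intro τ
      refine ((h.hasDerivAt τ).norm_sq.const_mul (1 / 2)).congr_deriv ?_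
      rw [real_inner_comm]
      ring
    rw [intervalIntegral.integral_eq_sub_of_hasDerivAt (fun τ _ => hd τ) iw, hwq, hwr]
    simp
  have := hr hqr
  rw [hint, intervalIntegral.integral_sub ((iD.sub iR).sub iw) iK,
    intervalIntegral.integral_sub (iD.sub iR) iw, intervalIntegral.integral_sub iD iR, hzero,
    hwq, hwr, relEnergy_zero_right, relEnergy_zero_right] at this
  rw [totalEnergy, totalEnergy]
  linarith

lemma isC1Test_zero : IsC1Test Ω (0 : ℝ → Vec d → Vec d) where
  support := ⟨∅, isCompact_empty, Set.empty_subset _, fun _ _ _ => rfl⟩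
  smooth _ := contDiff_const
  solenoidal t x := by simp [divergence]
  differentiable x := differentiable_const _
  smooth_deriv t := by simpa using contDiff_const
  continuous n := by simpa [iteratedFDeriv_fun_zero] using continuous_const
  continuous_deriv n := by simpa [iteratedFDeriv_fun_zero] using continuous_const

/-- If |x| > y, a large |n| with the sign opposite to x makes the left side positive. -/
lemma abs_le_of_forall_int {c x y : ℝ} (h : ∀ n : ℤ, c - n * x - |(n : ℝ)| * y ≤ 0) : |x| ≤ y := by
  by_contra! hlt
  obtain ⟨n, hn⟩ := exists_nat_gt (-c / (|x| - y))
  rw [div_lt_iff₀ (sub_pos.2 hlt)] at hn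
  have h1 := h n
  have h2 := h (-n)
  push_cast at h1 h2
  rw [abs_neg] at h2
  rw [Nat.abs_cast] at h1 h2
  rcases abs_cases x with ⟨e, -⟩ | ⟨e, -⟩ <;> rw [e] at hn <;> nlinarith

lemma exists_mem_Ioo_of_ae_timeMeasure {P : ℝ → Prop} (h : ∀ᵐ t ∂timeMeasure T, P t) {a b : ℝ}
    (ha : 0 ≤ a) (hab : a < b) (hb : b ≤ T) : ∃ t ∈ Set.Ioo a b, P t := by
  have hne : (ae (volume.restrict (Set.Ioo a b))).NeBot := by
    rw [ae_restrict_neBot, Real.volume_Ioo]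
    simpa using hab
  have h1 : ∀ᵐ t ∂volume.restrict (Set.Ioo a b), P t :=
    ae_mono (Measure.restrict_mono (Set.Ioo_subset_Ioo ha hb) le_rfl) h
  exact (((ae_restrict_mem measurableSet_Ioo).and h1).exists).imp fun t ht => ⟨ht.1, ht.2⟩

end Time

end EVS

end

/-! ### The proposition, by scaling the test field -/

theorem proposition2 {d : ℕ} (hd : 2 ≤ d) (Ω : Set (EVS.Vec d))
    (hΩ : EVS.IsBoundedLipschitzDomain Ω) (ν T : ℝ) (hν : 0 ≤ ν) (hT : 0 < T)
    (f : EVS.Force Ω) (hf : EVS.MemZ ν T f) (v₀ : EVS.L2sigma Ω)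
    (v : ℝ → EVS.L2sigma Ω) (ξ : ℝ → ℝ)
    (hsol : EVS.IsEnergyVariationalSolution ν T f v₀ v ξ)
    (K : EVS.L2sigma Ω → ℝ≥0∞) (hK : EVS.IsAdmissible ν T K)
    (hhom : ∀ (α : ℝ) (u : EVS.L2sigma Ω), K (α • u) = ENNReal.ofReal |α| * K u)
    (s t : ℝ) (hs : 0 < s) (hst : s < t) (ht : t < T) :
    (IntervalIntegrable (EVS.dissipation ν f v) volume s t ∧
      ∀ᵐ q ∂volume.restrict (Set.Ioo s t), ∀ᵐ r ∂volume.restrict (Set.Ioo s t), q < r →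
        EVS.totalEnergy v ξ r - EVS.totalEnergy v ξ q
          + ∫ τ in q..r, EVS.dissipation ν f v τ ≤ 0) ∧
    ∀ (φ : ℝ → EVS.Vec d → EVS.Vec d) (w : ℝ → EVS.L2sigma Ω), EVS.IsC1cTest Ω s t φ →
      (∀ τ, (w τ : EVS.L2 Ω) =ᵐ[volume.restrict Ω] φ τ) → w ∈ EVS.domK ν T K →
      IntervalIntegrable (EVS.residual ν f v φ w) volume s t ∧
      IntervalIntegrable (fun τ => (K (w τ)).toReal * ξ τ) volume s t ∧
      (∫ τ in s..t, EVS.residual ν f v φ w τ) ∈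
        Metric.closedBall (0 : ℝ) (∫ τ in s..t, (K (w τ)).toReal * ξ τ) := by
  have hO := hΩ.isOpen
  have : IsFiniteMeasure (volume.restrict Ω) :=
    ⟨by simpa using hΩ.isBounded.measure_lt_top⟩
  have hsub : volume.restrict (Set.Ioo s t) ≤ EVS.timeMeasure T :=
    Measure.restrict_mono (Set.Ioo_subset_Ioo hs.le ht.le) le_rfl
  have iD := EVS.integrable_dissipation hO hν hf hsol.memX
  refine ⟨⟨iD.intervalIntegrable_of_timeMeasure hs hst.le ht, ?_⟩, ?_⟩
  -- The zero field vanishes at every time, so almost all q < r are allowed.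
  · obtain ⟨w', H, U, g, h⟩ := EVS.isC1Test_zero.exists_isTestCurve (Ω := Ω) (w := 0)
      (fun _ => Lp.coeFn_zero _ _ _)
    have hres : EVS.residual ν f v 0 0 = 0 := by
      funext τ
      simpa using h.residual_smul hO ν f v 0 τ
    filter_upwards [ae_mono hsub (hsol.inequality_of_isTestCurve hO hν hf hK h)] with q hq
    filter_upwards [ae_mono hsub hq] with r hr hqr
    simpa [hres, hK.map_zero] using hr hqr rfl rfl
  · rintro φ w ⟨hφ, a, b, hsa, hab, hbt, h0⟩ hw hwK
    obtain ⟨w', H, U, g, h⟩ := hφ.exists_isTestCurve hw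
    have iR := h.integrable_residual hO hν hf hsol.memX
    have iK := EVS.integrable_toReal_mul hwK hsol.memLp_xi
    refine ⟨iR.intervalIntegrable_of_timeMeasure hs hst.le ht,
      iK.intervalIntegrable_of_timeMeasure hs hst.le ht, ?_⟩
    have hw0 : ∀ τ ∉ Set.Icc a b, w τ = 0 := fun τ hτ => by
      refine Subtype.ext (Lp.ext ?_)
      have hφ0 : φ τ = 0 := funext (h0 τ hτ)
      have := hw τ
      rw [hφ0] at this
      exact this.trans (Lp.coeFn_zero _ _ _).symm
    have hw0' : ∀ τ ∉ Set.Icc a b, w' τ = 0 := fun τ hτ => by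
      refine (h.hasDerivAt τ).unique ((hasDerivAt_const τ 0).congr_of_eventuallyEq ?_)
      filter_upwards [isClosed_Icc.isOpen_compl.mem_nhds hτ] with σ hσ
      exact hw0 σ hσ
    have sR : Function.support (EVS.residual ν f v φ w) ⊆ Set.Icc a b := fun τ hτ =>
      by_contra fun hn => hτ (h.residual_eq_zero hO ν f v (hw0 τ hn) (hw0' τ hn))
    have sK : Function.support (fun τ => (K (w τ)).toReal * ξ τ) ⊆ Set.Icc a b := fun τ hτ =>
      by_contra fun hn => hτ (by simp [hw0 τ hn, hK.map_zero])
    -- Countably many multiples nw share one exceptional null set of times.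
    have hall := ae_all_iff.2 fun n : ℤ =>
      hsol.inequality_of_isTestCurve hO hν hf hK (h.smul (n : ℝ))
    -- Good times q in (s, a) and r in (b, t) enclose the time support, so w vanishes at both.
    obtain ⟨q, ⟨hsq, hqa⟩, hq⟩ := EVS.exists_mem_Ioo_of_ae_timeMeasure hall hs.le hsa
      (hab.trans (hbt.trans ht).le)
    obtain ⟨r, ⟨hbr, hrt⟩, hr⟩ := EVS.exists_mem_Ioo_of_ae_timeMeasure (ae_all_iff.2 hq)
      (hs.trans (hsa.trans_le hab)).le hbt ht.le
    have hIqr : Set.Icc a b ⊆ Set.Ioc q r := fun τ hτ => ⟨hqa.trans_le hτ.1, hτ.2.trans hbr.le⟩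
    have hIst : Set.Icc a b ⊆ Set.Ioc s t := fun τ hτ => ⟨hsa.trans_le hτ.1, hτ.2.trans hbt.le⟩
    have key : |∫ τ in q..r, EVS.residual ν f v φ w τ| ≤
        ∫ τ in q..r, (K (w τ)).toReal * ξ τ := by
      refine EVS.abs_le_of_forall_int (c := EVS.totalEnergy v ξ r - EVS.totalEnergy v ξ q +
        ∫ τ in q..r, EVS.dissipation ν f v τ) fun n => ?_
      have hn := hr n (hqa.trans_le (hab.trans hbr.le))
        (by simp [hw0 q fun h' => absurd h'.1 (not_le.2 hqa)])
        (by simp [hw0 r fun h' => absurd h'.2 (not_le.2 hbr)])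
      -- Homogeneity of degree one makes this term grow like |n|, at the same rate as the residual
      -- term.
      have eK : ∀ τ, (K (((n : ℝ) • w) τ)).toReal * ξ τ =
          |(n : ℝ)| * ((K (w τ)).toReal * ξ τ) := fun τ => by
        rw [Pi.smul_apply, hhom, ENNReal.toReal_mul, ENNReal.toReal_ofReal (abs_nonneg _), mul_assoc]
      simp only [h.residual_smul hO, eK, intervalIntegral.integral_const_mul] at hn
      linarith
    -- Both integrands are supported in [a, b], so the integrals over (s, t) and (q, r) both equal
    -- the integral over ℝ.
    rw [mem_closedBall_zero_iff, Real.norm_eq_abs,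
      intervalIntegral.integral_eq_integral_of_support_subset (sR.trans hIst),
      intervalIntegral.integral_eq_integral_of_support_subset (sK.trans hIst),
      ← intervalIntegral.integral_eq_integral_of_support_subset (sR.trans hIqr),
      ← intervalIntegral.integral_eq_integral_of_support_subset (sK.trans hIqr)]
    exact key
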